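/- Let $h\in\mathbb R$ and $p_4(x,y,\xi,\eta;h)=\tfrac12x(x^2+y^2+\xi^2+\eta^2)-\tfrac52hx$ on $\mathbb R^4$, with $\xi,\eta$ dual to $x,y$. Its Hamilton equations are $$\dot x=x\xi,\quad \dot y=x\eta,\quad \dot\xi=-x^2-\tfrac12(x^2+y^2+\xi^2+\eta^2)+\tfrac52h,\quad \dot\eta=-xy.$$ Let $I\ni0$ be any open interval of times. Along every solution on $I$ the quantities $C_0=p_4(x,y,\xi,\eta;h)$ and $C_1^2=y^2+\eta^2$ are constant. Write $\alpha=C_1^2-5h$, $y_0=y(0)$, $\eta_0=\eta(0)$ with $y_0^2+\eta_0^2=C_1^2$, and let (R) be the assertion that on $I$ $$y(t)=y_0\cos\int_0^tx\,ds+\eta_0\sin\int_0^tx\,ds,\qquad \eta(t)=-y_0\sin\int_0^tx\,ds+\eta_0\cos\int_0^tx\,ds.$$ **1. $C_0\neq0$.** Every solution satisfies $x\ne0$, $\xi=\dot x/x$ and $\frac1x\frac{d}{dt}\big(\frac1x\dot y\big)+y=0$ on $I$. Let $g_2=\tfrac1{12}\alpha^2$ and $g_3=\tfrac1{216}\alpha^3+\tfrac14C_0^2$.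 (a) If $g_2^3-27g_3^2\neq0$, there is a lattice with invariants $g_2,g_3$ having a $\mathbb Z$-basis $\omega_1,\omega_2$ with $\omega_1$ purely imaginary. For each such basis let $\wp$ be its Weierstrass function. For $t_0\in\mathbb R\cup(\mathbb R+\tfrac12\omega_1)$ and real $t$ with $t+t_0$ not in the lattice, $\wp(t+t_0)$ and $\wp'(t+t_0)$ are real and $\wp(t+t_0)+\tfrac1{12}\alpha\ne0$. Functions $(x,y,\xi,\eta)$ solve Hamilton's equations on $I$ with $p_4=C_0$ at $t=0$ (given $y_0^2+\eta_0^2=C_1^2$) if and only if (R) holds and, for some $t_0\in\mathbb R\cup(\mathbb R+\tfrac12\omega_1)$, one has for all $t\in I$ that $t+t_0$ is not in the lattice and $$x(t)=\tfrac12C_0\left(\wp(t+t_0)+\tfrac1{12}\alpha\right)^{-1},\qquad \xi(t)=\frac{-\wp'(t+t_0)}{\wp(t+t_0)+\tfrac1{12}\alpha}.$$ (b) If $g_2^3-27g_3^2=0$, then $\alpha<0$. With $c=-\alpha/12$ (so $g_2=12c^2$, $g_3=8c^3$) let $\wp(s)=-c+3c\,\sin^{-2}(\sqrt{3c}\,s)$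 be the degenerate Weierstrass function. The solutions on $I$ with $p_4=C_0$ at $t=0$ are exactly those functions for which (R) holds and which either are given by the two formulas of (a) for some $t_0\in\mathbb R$ such that $\sin(\sqrt{3c}\,(t+t_0))\neq0$ on $I$, or satisfy $x\equiv3C_0/\alpha$, $\xi\equiv0$. **2. $C_0=0$.** The solutions on $I$ with $p_4=0$ at $t=0$ are exactly the following (with $t_0\in\mathbb R$ arbitrary, subject to the formula having no singularity on $I$). - $\alpha>0$: $x\equiv0$, $y\equiv y_0$, $\eta\equiv\eta_0$, $\xi(t)=-\sqrt\alpha\,\tan(\tfrac12\sqrt\alpha\,(t+t_0))$. - $\alpha=0$: $x\equiv0$, $y\equiv y_0$, $\eta\equiv\eta_0$, and $\xi\equiv0$ or $\xi(t)=\frac{2}{t+t_0}$. - $\alpha<0$, with $m=\sqrt{-\alpha}$: either $x(t)=\pm m\,\mathrm{sech}(m(t+t_0))$, $\xi(t)=-m\tanh(m(t+t_0))$ and (R); or $x\equiv0$, $y\equiv y_0$, $\eta\equiv\eta_0$ and $\xi(t)=m\tanh(\tfrac m2(t+t_0))$, or $\xi(t)=m\coth(\tfrac m2(t+t_0))$,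 or $\xi\equiv m$, or $\xi\equiv-m$. **3. Stationary points.** If $h\ge0$, the stationary points are exactly $(x,y,\xi,\eta)=(\pm\sqrt{5h/3},0,0,0)$ and $(0,y_0,\pm\sqrt{5h-y_0^2-\eta_0^2},\eta_0)$ with $y_0^2+\eta_0^2\le5h$. -/

import Mathlib

noncomputable section

/-- The symbol `p₄(x, y, ξ, η; h)`. -/
def p4 (h x y ξ η : ℝ) : ℝ :=
  1 / 2 * x * (x ^ 2 + y ^ 2 + ξ ^ 2 + η ^ 2) - 5 / 2 * h * x

/-- The curve `(x, y, ξ, η)` solves Hamilton's equations for `H` at every time in `I`: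
`x' = ∂H/∂ξ`, `y' = ∂H/∂η`, `ξ' = -∂H/∂x`, `η' = -∂H/∂y`. -/
structure IsHamiltonTrajectory (H : ℝ → ℝ → ℝ → ℝ → ℝ) (I : Set ℝ) (x y ξ η : ℝ → ℝ) :
    Prop where
  dx : ∀ t ∈ I, HasDerivAt x (deriv (fun s => H (x t) (y t) s (η t)) (ξ t)) t
  dy : ∀ t ∈ I, HasDerivAt y (deriv (fun s => H (x t) (y t) (ξ t) s) (η t)) t
  dξ : ∀ t ∈ I, HasDerivAt ξ (-deriv (fun s => H s (y t) (ξ t) (η t)) (x t)) t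
  dη : ∀ t ∈ I, HasDerivAt η (-deriv (fun s => H (x t) s (ξ t) (η t)) (y t)) t

/-- An open interval of times (bounded or not) that contains the initial time `0`. -/
structure IsTimeInterval (I : Set ℝ) : Prop where
  isOpen : IsOpen I
  ordConnected : I.OrdConnected
  zero_mem : (0 : ℝ) ∈ I

/-- On `I` the pair `(y, η)` is the initial pair `(y 0, η 0)` rotated by the angle `∫₀ᵗ x`. -/
def RotatesBy (I : Set ℝ) (x y η : ℝ → ℝ) : Prop :=
  ∀ t ∈ I,
    y t = y 0 * Real.cos (∫ s in (0 : ℝ)..t, x s) + η 0 * Real.sin (∫ s in (0 : ℝ)..t, x s) ∧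
    η t = -(y 0) * Real.sin (∫ s in (0 : ℝ)..t, x s) + η 0 * Real.cos (∫ s in (0 : ℝ)..t, x s)

/-- On `I` the functions `x, y, η` are constant, with `x = 0`. -/
def StaysAtZero (I : Set ℝ) (x y η : ℝ → ℝ) : Prop :=
  ∀ t ∈ I, x t = 0 ∧ y t = y 0 ∧ η t = η 0

/-- The invariant `g₂`, with `α = C₁² - 5h`. -/
def invG2 (α : ℝ) : ℝ := 1 / 12 * α ^ 2

/-- The invariant `g₃`, with `α = C₁² - 5h`. -/
def invG3 (α C₀ : ℝ) : ℝ := 1 / 216 * α ^ 3 + 1 / 4 * C₀ ^ 2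

/-- `L` is a pair of periods of the Weierstrass function with invariants `g₂, g₃`, the first of
which is purely imaginary. -/
def HasInvariants (L : PeriodPair) (g₂ g₃ : ℝ) : Prop :=
  L.g₂ = (g₂ : ℂ) ∧ L.g₃ = (g₃ : ℂ) ∧ L.ω₁.re = 0

/-- The admissible time shifts: a real number, or a real number plus the purely imaginary
half-period `ω₁ / 2`. -/
def timeShifts (L : PeriodPair) : Set ℂ :=
  {z | ∃ r : ℝ, z = (r : ℂ) ∨ z = (r : ℂ) + L.ω₁ / 2}

/-- On `I`, `x` and `ξ` are given by the Weierstrass function of `L`, with time shift `t₀`; no pole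
of this function is met. -/
def IsEllipticCurveMotion (L : PeriodPair) (α C₀ : ℝ) (t₀ : ℂ) (I : Set ℝ) (x ξ : ℝ → ℝ) : Prop :=
  ∀ t ∈ I, (t : ℂ) + t₀ ∉ L.lattice ∧
    (x t : ℂ) = 1 / 2 * C₀ * (L.weierstrassP (t + t₀) + 1 / 12 * α)⁻¹ ∧
    (ξ t : ℂ) = -L.derivWeierstrassP (t + t₀) / (L.weierstrassP (t + t₀) + 1 / 12 * α)

/-- The degenerate Weierstrass function with invariants `g₂ = 12c²`, `g₃ = 8c³` on the real line,
for `c > 0` (the case in which `4X³ - g₂X - g₃` has the double root `-c`). -/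
def degenerateWP (c s : ℝ) : ℝ := -c + 3 * c / Real.sin (√(3 * c) * s) ^ 2

end

/-! Since y² + η² is conserved, the ξ-equation closes up: (x, ξ) solves x' = xξ, ξ' = -(3x² + ξ² +
α)/2 with energy x(x² + ξ² + α)/2, and (y, η) follows by a rotation through ∫x
(`isHamiltonTrajectory_iff_isReducedTrajectory`).

If C₀ ≠ 0, then x never vanishes, and P = C₀/(2x) - α/12 turns the planar system into P'' = 6P² -
g₂/2 on the cubic P'² = 4P³ - g₂P - g₃. The second-order equation is a smooth vector field, so
solutions are unique even where P' = 0, and a motion is determined by its initial point on the real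
cubic. Explicit solutions blow up at their poles, so a motion that starts on one follows it and
never meets a pole (`notMem_and_eq_of_hasDerivAt_autonomous`). It remains to parametrise the real
points of the cubic. In the nonsingular case ℘ is surjective by Liouville, (℘, ℘') separates points
modulo the lattice, and conjugation symmetry confines the parameter to the admissible shifts
(`exists_timeShift_weierstrassP_eq`). In the singular case the sine formula reaches everything but
the node, which gives the constant motion.

A lattice with prescribed real invariants is found among rectangular lattices (positive
discriminant) and rhombic ones (negative). The scale-invariant quantity g₃/√|Δ| is continuous in the
shape y, tends to infinity with y, and is odd under y ↦ 1/y, hence takes every real value; scaling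
does the rest (`exists_diagonalPair`).

If C₀ = 0, either x ≡ 0 and ξ solves a Riccati equation, or x² + ξ² = -α and the motion is a
sech/tanh pair. -/

open Filter Topology Set

/-! ### Uniqueness for autonomous equations, up to blow-up -/

section ODE

/-- Near a time at which they agree, two solutions of an autonomous `C¹` equation coincide. -/
theorem eventuallyEq_of_hasDerivAt_autonomous {E : Type*} [NormedAddCommGroup E] [NormedSpace ℝ E]
    {v : E → E} (hv : ContDiff ℝ 1 v) {u w : ℝ → E} {t : ℝ}
    (hu : ∀ᶠ s in 𝓝 t, HasDerivAt u (v (u s)) s) (hw : ∀ᶠ s in 𝓝 t, HasDerivAt w (v (w s)) s)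
    (h : u t = w t) : u =ᶠ[𝓝 t] w := by
  obtain ⟨K, S, hS, hK⟩ := (hv.contDiffAt (x := u t)).exists_lipschitzOnWith
  refine ODE_solution_unique_of_eventually (v := fun _ => v) (s := fun _ => S) (K := K)
    (Eventually.of_forall fun _ => hK) (hu.and ?_) (hw.and ?_) h
  · exact hu.self_of_nhds.continuousAt.eventually_mem hS
  · exact hw.self_of_nhds.continuousAt.eventually_mem (h ▸ hS)

/-- Let `w` solve an autonomous `C¹` equation off a closed set `Z`, at whose points it blows up.
A solution `u` on an interval that agrees with `w` at one time outside `Z` agrees with `w` on the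
whole interval, which does not meet `Z`. -/
theorem notMem_and_eq_of_hasDerivAt_autonomous {E : Type*} [NormedAddCommGroup E]
    [NormedSpace ℝ E] {v : E → E} (hv : ContDiff ℝ 1 v) {I : Set ℝ} (hI : IsOpen I)
    (hc : IsPreconnected I) {Z : Set ℝ} (hZ : IsClosed Z) {u w : ℝ → E}
    (hu : ∀ t ∈ I, HasDerivAt u (v (u t)) t) (hw : ∀ t ∉ Z, HasDerivAt w (v (w t)) t)
    (hblow : ∀ t ∈ Z, Tendsto w (𝓝[≠] t) (Bornology.cobounded E)) {t₀ : ℝ} (h₀ : t₀ ∈ I)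
    (h₀Z : t₀ ∉ Z) (h : u t₀ = w t₀) : ∀ t ∈ I, t ∉ Z ∧ u t = w t := by
  set U : Set ℝ := {t | ∀ᶠ s in 𝓝 t, s ∉ Z ∧ u s = w s} with hU
  have key : ∀ t ∈ I, t ∉ Z → u t = w t → t ∈ U := fun t ht htZ hut =>
    (hZ.isOpen_compl.eventually_mem htZ).and (eventuallyEq_of_hasDerivAt_autonomous hv
      ((hI.eventually_mem ht).mono hu) ((hZ.isOpen_compl.eventually_mem htZ).mono hw) hut)
  have hsub : I ⊆ U := by
    -- The set of local agreement is open; by connectedness it is enough that it is closed relative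
    -- to `I`.
    refine hc.subset_of_closure_inter_subset isOpen_setOfPred_eventually_nhds
      ⟨t₀, h₀, key t₀ h₀ h₀Z h⟩ ?_
    rintro t ⟨htU, htI⟩
    have hfr : ∃ᶠ s in 𝓝 t, s ∉ Z ∧ u s = w s :=
      (mem_closure_iff_frequently.1 htU).mono fun s hs => hs.self_of_nhds
    have hut : Tendsto u (𝓝 t) (𝓝 (u t)) := (hu t htI).continuousAt
    by_cases htZ : t ∈ Z
    -- At a limit point in `Z`, `u` stays bounded while `w` is unbounded, yet they agree at points
    -- arbitrarily close by.
    · exfalso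
      have hfr' : ∃ᶠ s in 𝓝[≠] t, u s = w s := by
        rw [frequently_nhdsWithin_iff]
        exact hfr.mono fun s hs => ⟨hs.2, fun hst => hs.1 (hst ▸ htZ)⟩
      have hb : ∀ᶠ s in 𝓝[≠] t, ‖u s‖ < ‖u t‖ + 1 :=
        nhdsWithin_le_nhds (hut.norm.eventually_lt_const (lt_add_one _))
      have hb' : ∀ᶠ s in 𝓝[≠] t, ‖u t‖ + 1 ≤ ‖w s‖ :=
        (tendsto_norm_atTop_iff_cobounded.2 (hblow t htZ)).eventually_ge_atTop _
      obtain ⟨s, hs, h1, h2⟩ := (hfr'.and_eventually (hb.and hb')).exists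
      rw [hs] at h1
      linarith
    · refine key t htI htZ ?_
      by_contra hne
      have hwt : Tendsto w (𝓝 t) (𝓝 (w t)) := (hw t htZ).continuousAt
      have : ∀ᶠ s in 𝓝 t, u s ≠ w s :=
        ((hut.sub hwt).eventually_ne (sub_ne_zero.2 hne)).mono fun s hs => sub_ne_zero.1 hs
      exact (hfr.and_eventually this).exists.elim fun s hs => hs.2 hs.1.2
  exact fun t ht => (hsub ht).self_of_nhds

end ODE

/-! ### The Weierstrass function: differential equation, values, and rigidity of the lattice -/

namespace PeriodPair

variable (L L' : PeriodPair)

theorem hasDerivAt_weierstrassP {z : ℂ} (hz : z ∉ L.lattice) :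
    HasDerivAt L.weierstrassP (L.derivWeierstrassP z) z := by
  have := (L.analyticOnNhd_weierstrassP z hz).differentiableAt.hasDerivAt
  rwa [L.deriv_weierstrassP] at this

theorem tendsto_weierstrassP_cobounded {z : ℂ} (hz : z ∈ L.lattice) :
    Tendsto L.weierstrassP (𝓝[≠] z) (Bornology.cobounded ℂ) := by
  refine tendsto_cobounded_of_meromorphicOrderAt_neg ?_
  rw [L.order_weierstrassP z hz]
  decide

theorem countable_lattice : (L.lattice : Set ℂ).Countable :=
  countable_of_Lindelof_of_discrete (X := L.lattice)

theorem isPreconnected_compl_lattice : IsPreconnected (L.lattice : Set ℂ)ᶜ :=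
  (L.countable_lattice.isConnected_compl_of_one_lt_rank (by
    rw [Complex.rank_real_complex]; norm_num)).isPreconnected

/-- Otherwise ℘ would be constant on the connected complement of the lattice, against its pole at 0.
This allows ℘' to be cancelled in the differentiated cubic relation. -/
theorem exists_notMem_lattice_derivWeierstrassP_ne_zero :
    ∃ z ∉ L.lattice, L.derivWeierstrassP z ≠ 0 := by
  by_contra! hcon
  have h0 := L.ω₁_div_two_notMem_lattice
  have hEq : EqOn L.weierstrassP (fun _ => L.weierstrassP (L.ω₁ / 2)) (L.lattice : Set ℂ)ᶜ := by
    intro z hz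
    refine L.isClosed_lattice.isOpen_compl.is_const_of_deriv_eq_zero L.isPreconnected_compl_lattice
      L.differentiableOn_weierstrassP ?_ hz h0
    intro w hw
    rw [L.deriv_weierstrassP]
    exact hcon w hw
  have hb := tendsto_norm_atTop_iff_cobounded.2 (L.tendsto_weierstrassP_cobounded L.lattice.zero_mem)
  have h1 := hb.eventually_ge_atTop (‖L.weierstrassP (L.ω₁ / 2)‖ + 1)
  have h2 : ∀ᶠ z in 𝓝[≠] (0 : ℂ), z ∉ L.lattice := by
    filter_upwards [self_mem_nhdsWithin, mem_nhdsWithin_of_mem_nhds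
      (L.compl_lattice_sdiff_singleton_mem_nhds 0)] with z hz hz' using by simp_all
  obtain ⟨z, hz, hz'⟩ := (h1.and h2).exists
  rw [hEq hz'] at hz
  linarith

/-- `℘'' = 6 ℘² - g₂ / 2`. -/
theorem hasDerivAt_derivWeierstrassP {z : ℂ} (hz : z ∉ L.lattice) :
    HasDerivAt L.derivWeierstrassP (6 * L.weierstrassP z ^ 2 - L.g₂ / 2) z := by
  have hP := L.analyticOnNhd_weierstrassP
  have hP' := L.analyticOnNhd_derivWeierstrassP
  -- Differentiating ℘'² = 4℘³ - g₂℘ - g₃ gives a product with factor ℘'; on a connected domain one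
  -- of the two analytic factors vanishes identically.
  have key := AnalyticOnNhd.eq_zero_or_eq_zero_of_mul_eq_zero (U := (L.lattice : Set ℂ)ᶜ)
    (f := L.derivWeierstrassP)
    (g := fun z => deriv L.derivWeierstrassP z - (6 * L.weierstrassP z ^ 2 - L.g₂ / 2))
    hP' (fun w hw => ?_) ?_ L.isPreconnected_compl_lattice
  · rcases key with h | h
    · obtain ⟨w, hw, hw'⟩ := L.exists_notMem_lattice_derivWeierstrassP_ne_zero
      exact absurd (h w hw) hw'
    · rw [← sub_eq_zero.1 (h z hz)]
      exact (hP' z hz).differentiableAt.hasDerivAt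
  · have h0 := (hP' w hw).deriv
    have h1 := hP w hw
    fun_prop
  · intro w hw
    have hd := (hP' w hw).differentiableAt.hasDerivAt
    have hd0 := L.hasDerivAt_weierstrassP hw
    have h1 := hd.pow 2
    have h2 := (((hd0.pow 3).const_mul 4).sub (hd0.const_mul L.g₂)).sub_const L.g₃
    have h3 : (L.derivWeierstrassP ^ 2) =ᶠ[𝓝 w]
        fun z => 4 * (L.weierstrassP ^ 3) z - L.g₂ * L.weierstrassP z - L.g₃ := by
      filter_upwards [L.isClosed_lattice.isOpen_compl.mem_nhds hw] with s hs
      simpa using L.derivWeierstrassP_sq s hs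
    have h4 := h1.unique (h2.congr_of_eventuallyEq h3)
    simp at h4
    linear_combination h4 / 2

/-- The Weierstrass function takes every complex value. -/
theorem exists_weierstrassP_eq (c : ℂ) : ∃ z ∉ L.lattice, L.weierstrassP z = c := by
  classical
  by_contra! hcon
  -- If c were omitted, 1/(℘ - c), set to 0 at the poles, would be entire and doubly periodic, hence
  -- constant by Liouville, hence 0.
  set f : ℂ → ℂ := fun z => if z ∈ L.lattice then 0 else (L.weierstrassP z - c)⁻¹ with hf
  have hoff : ∀ z ∉ L.lattice, DifferentiableAt ℂ f z := by
    intro z hz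
    have h1 : DifferentiableAt ℂ (fun z => (L.weierstrassP z - c)⁻¹) z :=
      ((L.hasDerivAt_weierstrassP hz).differentiableAt.sub_const c).inv (sub_ne_zero.2 (hcon z hz))
    refine h1.congr_of_eventuallyEq ?_
    filter_upwards [L.isClosed_lattice.isOpen_compl.mem_nhds hz] with s hs
    simp only [hf, if_neg (show s ∉ L.lattice from hs)]
  have hnear : ∀ z : ℂ, ∀ᶠ s in 𝓝[≠] z, s ∉ L.lattice := fun z => by
    filter_upwards [self_mem_nhdsWithin, mem_nhdsWithin_of_mem_nhds
      (L.compl_lattice_sdiff_singleton_mem_nhds z)] with s hs hs' using by simp_all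
  have hdiff : Differentiable ℂ f := by
    intro z
    by_cases hz : z ∈ L.lattice
    · have hcont : ContinuousAt f z := by
        rw [continuousAt_iff_punctured_nhds]
        have h1 : Tendsto (fun z => (L.weierstrassP z - c)⁻¹) (𝓝[≠] z) (𝓝 0) := by
          refine tendsto_inv₀_cobounded.comp ?_
          rw [← tendsto_norm_atTop_iff_cobounded]
          refine tendsto_atTop_mono (fun s => norm_sub_norm_le _ _) ?_
          exact tendsto_atTop_add_const_right _ _
            (tendsto_norm_atTop_iff_cobounded.2 (L.tendsto_weierstrassP_cobounded hz))
        have h0 : f z = 0 := by simp [hf, hz]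
        rw [h0]
        refine h1.congr' ?_
        filter_upwards [hnear z] with s hs
        simp only [hf, if_neg hs]
      refine (Complex.analyticAt_of_differentiable_on_punctured_nhds_of_continuousAt ?_
        hcont).differentiableAt
      filter_upwards [hnear z] with s hs using hoff s hs
    · exact hoff z hz
  have hconst := fun z => (hdiff.apply_eq_apply_of_bounded
    (IsZLattice.isCompact_range_of_periodic L.lattice f hdiff.continuous (fun z w hw => by
      have h1 : z + w ∈ L.lattice ↔ z ∈ L.lattice := L.lattice.add_mem_iff_left hw
      have h2 := L.weierstrassP_add_coe z ⟨w, hw⟩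
      simp only at h2
      simp only [hf, h1, h2])).isBounded z 0)
  have h0 : f 0 = 0 := by simp [hf]
  have h1 := hconst (L.ω₁ / 2)
  have h2 := L.ω₁_div_two_notMem_lattice
  rw [h0] at h1
  simp only [hf, if_neg h2, inv_eq_zero, sub_eq_zero] at h1
  exact hcon _ h2 h1

variable {L L'}

theorem contDiff_weierstrass_vectorField (g : ℂ) :
    ContDiff ℝ 1 (fun p : ℂ × ℂ => (p.2, 6 * p.1 ^ 2 - g / 2)) := by
  fun_prop

/-- The pair `(℘, ℘')` along a horizontal line solves `P' = Q`, `Q' = 6 P² - g₂ / 2`. -/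
theorem hasDerivAt_weierstrassP_pair (a : ℂ) {t : ℝ} (ht : (t : ℂ) + a ∉ L.lattice) :
    HasDerivAt (fun s : ℝ => (L.weierstrassP (s + a), L.derivWeierstrassP (s + a)))
      (L.derivWeierstrassP (t + a), 6 * L.weierstrassP (t + a) ^ 2 - L.g₂ / 2) t := by
  refine HasDerivAt.prodMk ?_ ?_
  · exact ((L.hasDerivAt_weierstrassP ht).comp_add_const (t : ℂ) a).comp_ofReal
  · exact ((L.hasDerivAt_derivWeierstrassP ht).comp_add_const (t : ℂ) a).comp_ofReal

/-- Translates of the Weierstrass functions of two lattices with the same `g₂` that agree to first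
order at one point have the same poles. -/
theorem mem_lattice_of_weierstrassP_eq (hg : L.g₂ = L'.g₂) {a b : ℂ} (ha : a ∉ L.lattice)
    (hb : b ∉ L'.lattice) (h : L.weierstrassP a = L'.weierstrassP b)
    (h' : L.derivWeierstrassP a = L'.derivWeierstrassP b) {s : ℂ} (hs : b + s ∈ L'.lattice) :
    a + s ∈ L.lattice := by
  by_contra hsL
  -- The two pole sets are countable, so the identity theorem applies on the connected complement of
  -- their union.
  set Z : Set ℂ := (fun z => a + z) ⁻¹' L.lattice ∪ (fun z => b + z) ⁻¹' L'.lattice with hZ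
  have hZc : Z.Countable := (L.countable_lattice.preimage (add_right_injective a)).union
    (L'.countable_lattice.preimage (add_right_injective b))
  have hconn : IsPreconnected Zᶜ := (hZc.isConnected_compl_of_one_lt_rank (by
    rw [Complex.rank_real_complex]; norm_num)).isPreconnected
  have hF : AnalyticOnNhd ℂ (fun z => L.weierstrassP (a + z)) Zᶜ := fun z hz =>
    (L.analyticOnNhd_weierstrassP (a + z) (fun hm => hz (Or.inl hm))).fun_comp (by fun_prop)
  have hG : AnalyticOnNhd ℂ (fun z => L'.weierstrassP (b + z)) Zᶜ := fun z hz =>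
    (L'.analyticOnNhd_weierstrassP (b + z) (fun hm => hz (Or.inr hm))).fun_comp (by fun_prop)
  have h0 : (0 : ℂ) ∈ Zᶜ := by simp [hZ, ha, hb]
  -- Uniqueness for the real-time equation P'' = 6P² - g₂/2, which involves only g₂, gives agreement
  -- on a real segment.
  have hreal : ∀ᶠ t : ℝ in 𝓝 0, L.weierstrassP (a + t) = L'.weierstrassP (b + t) := by
    have hev : ∀ (M : PeriodPair) (c : ℂ), c ∉ M.lattice →
        ∀ᶠ t : ℝ in 𝓝 0, (t : ℂ) + c ∉ M.lattice := by
      intro M c hc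
      have : ContinuousAt (fun t : ℝ => (t : ℂ) + c) 0 := by fun_prop
      exact this.eventually_mem (M.isClosed_lattice.isOpen_compl.mem_nhds (by simpa using hc))
    have := eventuallyEq_of_hasDerivAt_autonomous (t := 0) (contDiff_weierstrass_vectorField L.g₂)
      (u := fun s : ℝ => (L.weierstrassP (s + a), L.derivWeierstrassP (s + a)))
      (w := fun s : ℝ => (L'.weierstrassP (s + b), L'.derivWeierstrassP (s + b)))
      ((hev L a ha).mono fun t ht => hasDerivAt_weierstrassP_pair a ht)
      ((hev L' b hb).mono fun t ht => by
        rw [hg]; exact hasDerivAt_weierstrassP_pair b ht) (by simp [h, h'])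
    filter_upwards [this] with t ht
    rw [add_comm a, add_comm b]
    exact congrArg Prod.fst ht
  have hfreq : ∃ᶠ z in 𝓝[≠] (0 : ℂ), L.weierstrassP (a + z) = L'.weierstrassP (b + z) := by
    have ht : Tendsto (fun t : ℝ => (t : ℂ)) (𝓝[≠] 0) (𝓝[≠] 0) := by
      refine tendsto_nhdsWithin_iff.2 ⟨?_, ?_⟩
      · exact (Complex.continuous_ofReal.tendsto' 0 0 (by simp)).mono_left nhdsWithin_le_nhds
      · filter_upwards [self_mem_nhdsWithin] with t ht
        simpa using ht
    exact ht.frequently (Eventually.filter_mono nhdsWithin_le_nhds hreal).frequently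
  have hEq := hF.eqOn_of_preconnected_of_frequently_eq hG hconn h0 hfreq
  have hmap : ∀ c : ℂ, Tendsto (fun z => c + z) (𝓝[≠] s) (𝓝[≠] (c + s)) := by
    intro c
    refine tendsto_nhdsWithin_iff.2 ⟨?_, ?_⟩
    · exact ((continuous_const_add c).tendsto s).mono_left nhdsWithin_le_nhds
    · filter_upwards [self_mem_nhdsWithin] with t ht
      simpa using ht
  have hblow := (tendsto_norm_atTop_iff_cobounded.2
    (L'.tendsto_weierstrassP_cobounded hs)).comp (hmap b)
  have hfin : Tendsto (fun z => ‖L.weierstrassP (a + z)‖) (𝓝[≠] s) (𝓝 ‖L.weierstrassP (a + s)‖) :=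
    ((L.hasDerivAt_weierstrassP hsL).continuousAt.tendsto.comp
      ((hmap a).mono_right nhdsWithin_le_nhds)).norm
  have hne : ∀ (M : PeriodPair) (c : ℂ), ∀ᶠ z in 𝓝[≠] s, c + z ∉ M.lattice := by
    intro M c
    refine (hmap c).eventually (p := fun w => w ∉ M.lattice) ?_
    filter_upwards [self_mem_nhdsWithin, mem_nhdsWithin_of_mem_nhds
      (M.compl_lattice_sdiff_singleton_mem_nhds (c + s))] with w hw hw' using by simp_all
  obtain ⟨z, h1, h2, h3, h4⟩ := ((hblow.eventually_ge_atTop (‖L.weierstrassP (a + s)‖ + 1)).and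
    ((hfin.eventually_lt_const (lt_add_one _)).and ((hne L a).and (hne L' b)))).exists
  have := hEq (show z ∈ Zᶜ from fun hz => hz.elim h3 h4)
  simp only [Function.comp_apply] at h1 this
  rw [this] at h2
  linarith

/-- `℘` and `℘'` together separate points modulo the lattice. -/
theorem sub_mem_lattice_of_weierstrassP_eq {a b : ℂ} (ha : a ∉ L.lattice) (hb : b ∉ L.lattice)
    (h : L.weierstrassP a = L.weierstrassP b)
    (h' : L.derivWeierstrassP a = L.derivWeierstrassP b) : a - b ∈ L.lattice := by
  rw [sub_eq_add_neg]
  exact mem_lattice_of_weierstrassP_eq rfl ha hb h h' (by simp)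

/-- Every point of the affine curve `Y² = 4X³ - g₂X - g₃` is `(℘ z, ℘' z)` for some `z`. -/
theorem exists_weierstrassP_eq_and_derivWeierstrassP_eq {X Y : ℂ}
    (h : Y ^ 2 = 4 * X ^ 3 - L.g₂ * X - L.g₃) :
    ∃ z ∉ L.lattice, L.weierstrassP z = X ∧ L.derivWeierstrassP z = Y := by
  obtain ⟨z, hz, hzX⟩ := L.exists_weierstrassP_eq X
  have h1 : L.derivWeierstrassP z ^ 2 = Y ^ 2 := by rw [L.derivWeierstrassP_sq z hz, hzX, h]
  rcases sq_eq_sq_iff_eq_or_eq_neg.1 h1 with h2 | h2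
  · exact ⟨z, hz, hzX, h2⟩
  · exact ⟨-z, by simpa using hz, by simp [hzX], by simp [h2]⟩

/-- A lattice is determined by its invariants. -/
theorem lattice_le_of_invariants_eq (h₂ : L.g₂ = L'.g₂) (h₃ : L.g₃ = L'.g₃) :
    L'.lattice ≤ L.lattice := by
  have hb := L'.ω₁_div_two_notMem_lattice
  obtain ⟨a, ha, h, h'⟩ := L.exists_weierstrassP_eq_and_derivWeierstrassP_eq
    (X := L'.weierstrassP (L'.ω₁ / 2)) (Y := L'.derivWeierstrassP (L'.ω₁ / 2))
    (by rw [h₂, h₃]; exact L'.derivWeierstrassP_sq _ hb)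
  -- The pole sets match only up to the translation a - ω₁'/2; subtracting the case l = 0 removes
  -- it.
  have key : ∀ l ∈ L'.lattice, a - L'.ω₁ / 2 + l ∈ L.lattice := fun l hl => by
    have := mem_lattice_of_weierstrassP_eq h₂ ha hb h h' (s := l - L'.ω₁ / 2) (by simpa using hl)
    rwa [show a + (l - L'.ω₁ / 2) = a - L'.ω₁ / 2 + l by ring] at this
  intro l hl
  have := sub_mem (key l hl) (key 0 (zero_mem _))
  rwa [show a - L'.ω₁ / 2 + l - (a - L'.ω₁ / 2 + 0) = l by ring] at this

end PeriodPair

/-! ### Complex conjugation and real values of ℘ -/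

namespace PeriodPair

open ComplexConjugate

variable (L : PeriodPair)

/-- The pair of complex conjugate periods. -/
def conjPair : PeriodPair where
  ω₁ := conj L.ω₁
  ω₂ := conj L.ω₂
  indep := by
    have h := LinearIndependent.pair_iff.1 L.indep
    refine LinearIndependent.pair_iff.2 fun s t hst => h s t ?_
    have := congrArg conj hst
    simpa using this

theorem conj_mem_lattice_conjPair {z : ℂ} : conj z ∈ L.conjPair.lattice ↔ z ∈ L.lattice := by
  rw [mem_lattice, mem_lattice]
  refine exists_congr fun m => exists_congr fun n => ?_
  rw [← (starRingEnd ℂ).injective.eq_iff]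
  simp [conjPair]

theorem G_conjPair (k : ℕ) : L.conjPair.G k = conj (L.G k) := by
  rw [G, G, Complex.conj_tsum]
  refine (((starRingAut : ℂ ≃+* ℂ).toEquiv.subtypeEquiv fun z =>
    (L.conj_mem_lattice_conjPair (z := z)).symm).tsum_eq _).symm.trans ?_
  refine tsum_congr fun l => ?_
  simp

variable {L}

/-- If both invariants are real, the lattice is stable under complex conjugation. -/
theorem conj_mem_lattice (h₂ : conj L.g₂ = L.g₂) (h₃ : conj L.g₃ = L.g₃) {z : ℂ}
    (hz : z ∈ L.lattice) : conj z ∈ L.lattice := by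
  refine lattice_le_of_invariants_eq (L := L) (L' := L.conjPair) ?_ ?_
    (L.conj_mem_lattice_conjPair.2 hz)
  · rw [← h₂, g₂, g₂, G_conjPair, map_mul, map_ofNat]
  · rw [← h₃, g₃, g₃, G_conjPair, map_mul, map_ofNat]

/-- Conjugation permutes the lattice, so it only reindexes the defining series. -/
theorem weierstrassP_conj (hL : ∀ z ∈ L.lattice, conj z ∈ L.lattice) (z : ℂ) :
    L.weierstrassP (conj z) = conj (L.weierstrassP z) := by
  have hL' : ∀ z, z ∈ L.lattice ↔ (starRingAut : ℂ ≃+* ℂ).toEquiv z ∈ L.lattice := fun z =>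
    ⟨hL z, fun h => by simpa using hL _ h⟩
  rw [weierstrassP, weierstrassP, Complex.conj_tsum]
  refine (((starRingAut : ℂ ≃+* ℂ).toEquiv.subtypeEquiv hL').tsum_eq _).symm.trans ?_
  refine tsum_congr fun l => ?_
  simp

theorem derivWeierstrassP_conj (hL : ∀ z ∈ L.lattice, conj z ∈ L.lattice) (z : ℂ) :
    L.derivWeierstrassP (conj z) = conj (L.derivWeierstrassP z) := by
  have hL' : ∀ z, z ∈ L.lattice ↔ (starRingAut : ℂ ≃+* ℂ).toEquiv z ∈ L.lattice := fun z =>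
    ⟨hL z, fun h => by simpa using hL _ h⟩
  rw [derivWeierstrassP, derivWeierstrassP, map_neg, Complex.conj_tsum]
  refine congrArg Neg.neg ?_
  refine (((starRingAut : ℂ ≃+* ℂ).toEquiv.subtypeEquiv hL').tsum_eq _).symm.trans ?_
  refine tsum_congr fun l => ?_
  simp [map_ofNat (starRingEnd ℂ)]

/-- If `z` and its conjugate are congruent modulo a conjugation-stable lattice, then `℘ z` and
`℘' z` are real. -/
theorem im_weierstrassP_eq_zero (hL : ∀ z ∈ L.lattice, conj z ∈ L.lattice) {z : ℂ}
    (hz : z - conj z ∈ L.lattice) :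
    (L.weierstrassP z).im = 0 ∧ (L.derivWeierstrassP z).im = 0 := by
  constructor
  · rw [← Complex.conj_eq_iff_im, ← weierstrassP_conj hL,
      ← L.weierstrassP_add_coe (conj z) ⟨_, hz⟩]
    simp
  · rw [← Complex.conj_eq_iff_im, ← derivWeierstrassP_conj hL,
      ← L.derivWeierstrassP_add_coe (conj z) ⟨_, hz⟩]
    simp

/-- Two purely imaginary periods would be linearly dependent over ℝ. -/
theorem ω₂_re_ne_zero (h : L.ω₁.re = 0) : L.ω₂.re ≠ 0 := by
  intro h2
  have h' := LinearIndependent.pair_iff.1 L.indep L.ω₂.im (-L.ω₁.im)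
    (by apply Complex.ext <;> simp [h, h2]; ring)
  have h1 : L.ω₁ = 0 := Complex.ext h (by simpa using h'.2)
  exact L.indep.ne_zero 0 (by simpa using h1)

/-- For a purely imaginary period `ω₁`, the points congruent to their conjugates are, modulo the
lattice, the admissible time shifts. -/
theorem exists_timeShift_sub_mem_lattice (h : L.ω₁.re = 0) {z : ℂ} (hz : z - conj z ∈ L.lattice) :
    ∃ t₀ ∈ timeShifts L, z - t₀ ∈ L.lattice := by
  obtain ⟨m, n, hmn⟩ := mem_lattice.1 hz
  -- The difference of z and its conjugate is imaginary, so ω₂ cannot occur in it. Thus 2i Im z =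
  -- mω₁, and the parity of m selects the kind of shift.
  have hn : (n : ℝ) = 0 := by
    have := congrArg Complex.re hmn
    simp [h] at this
    rcases this with h' | h'
    · exact_mod_cast h'
    · exact absurd h' (L.ω₂_re_ne_zero h)
  have hn' : (n : ℂ) = 0 := by exact_mod_cast hn
  rw [hn', zero_mul, add_zero, Complex.sub_conj] at hmn
  have hzz : z = (z.re : ℂ) + m * (L.ω₁ / 2) := by
    apply Complex.ext
    · simp [h]
    · have := congrArg Complex.im hmn
      simp at this
      simp
      linarith
  rcases Int.even_or_odd' m with ⟨k, rfl | rfl⟩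
  · refine ⟨z.re, ⟨z.re, Or.inl rfl⟩, mem_lattice.2 ⟨k, 0, ?_⟩⟩
    push_cast at hzz ⊢
    linear_combination -hzz
  · refine ⟨z.re + L.ω₁ / 2, ⟨z.re, Or.inr rfl⟩, mem_lattice.2 ⟨k, 0, ?_⟩⟩
    push_cast at hzz ⊢
    linear_combination -hzz

theorem sub_conj_mem_lattice_of_mem_timeShifts (h : L.ω₁.re = 0) {t₀ : ℂ} (ht₀ : t₀ ∈ timeShifts L)
    (t : ℝ) : (t + t₀) - conj (t + t₀) ∈ L.lattice := by
  obtain ⟨r, rfl | rfl⟩ := ht₀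
  · simp
  · have h1 : conj L.ω₁ = -L.ω₁ := Complex.ext (by simp [h]) (by simp)
    refine mem_lattice.2 ⟨1, 0, ?_⟩
    rw [map_add, map_add, map_div₀, map_ofNat, h1, Complex.conj_ofReal, Complex.conj_ofReal]
    push_cast
    ring

/-- Every real point of the curve `Y² = 4X³ - g₂X - g₃` is `(℘ t₀, ℘' t₀)` for an admissible time
shift `t₀`. -/
theorem exists_timeShift_weierstrassP_eq (hL : ∀ z ∈ L.lattice, conj z ∈ L.lattice)
    (h : L.ω₁.re = 0) {X Y : ℝ} (hXY : (Y : ℂ) ^ 2 = 4 * X ^ 3 - L.g₂ * X - L.g₃) :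
    ∃ t₀ ∈ timeShifts L, t₀ ∉ L.lattice ∧ L.weierstrassP t₀ = X ∧ L.derivWeierstrassP t₀ = Y := by
  obtain ⟨z, hz, hX, hY⟩ := exists_weierstrassP_eq_and_derivWeierstrassP_eq hXY
  have hz' : conj z ∉ L.lattice := fun hm => hz (by simpa using hL _ hm)
  -- As X and Y are real, z and its conjugate have the same (℘, ℘') and are therefore congruent.
  obtain ⟨t₀, ht₀, hl⟩ := exists_timeShift_sub_mem_lattice h (z := z)
    (sub_mem_lattice_of_weierstrassP_eq hz hz' (by rw [weierstrassP_conj hL, hX, Complex.conj_ofReal])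
      (by rw [derivWeierstrassP_conj hL, hY, Complex.conj_ofReal]))
  refine ⟨t₀, ht₀, fun hm => hz (by simpa using add_mem hl hm), ?_, ?_⟩
  · rw [← hX, ← L.weierstrassP_add_coe t₀ ⟨_, hl⟩]; simp
  · rw [← hY, ← L.derivWeierstrassP_add_coe t₀ ⟨_, hl⟩]; simp

/-! ### Half-periods and the discriminant -/

/-- ℘' is odd and periodic, and here z ≡ -z. -/
theorem derivWeierstrassP_eq_zero_of_two_mul_mem {z : ℂ} (hz : 2 * z ∈ L.lattice) :
    L.derivWeierstrassP z = 0 := by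
  have h1 := L.derivWeierstrassP_add_coe (-z) ⟨_, hz⟩
  rw [derivWeierstrassP_neg, show -z + ((⟨2 * z, hz⟩ : L.lattice) : ℂ) = z by simp; ring] at h1
  linear_combination h1 / 2

theorem weierstrassP_ne_of_two_mul_mem {a b : ℂ} (ha : a ∉ L.lattice) (hb : b ∉ L.lattice)
    (ha' : 2 * a ∈ L.lattice) (hb' : 2 * b ∈ L.lattice) (hab : a - b ∉ L.lattice) :
    L.weierstrassP a ≠ L.weierstrassP b := fun h =>
  hab (sub_mem_lattice_of_weierstrassP_eq ha hb h (by
    rw [derivWeierstrassP_eq_zero_of_two_mul_mem ha', derivWeierstrassP_eq_zero_of_two_mul_mem hb']))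

theorem half_ω₁_add_half_ω₂_notMem_lattice : (L.ω₁ + L.ω₂) / 2 ∉ L.lattice := by
  have := (L.mul_ω₁_add_mul_ω₂_mem_lattice (α := 1 / 2) (β := 1 / 2)).not.mpr (by norm_num)
  push_cast at this
  rwa [show (L.ω₁ + L.ω₂) / 2 = 1 / 2 * L.ω₁ + 1 / 2 * L.ω₂ by ring]

theorem half_ω₁_sub_half_ω₂_notMem_lattice : (L.ω₁ - L.ω₂) / 2 ∉ L.lattice := fun h =>
  L.half_ω₁_add_half_ω₂_notMem_lattice (by
    have := add_mem h L.ω₂_mem_lattice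
    rwa [show (L.ω₁ - L.ω₂) / 2 + L.ω₂ = (L.ω₁ + L.ω₂) / 2 by ring] at this)

/-- The discriminant of `4X³ - g₂X - g₃` in terms of three distinct roots. -/
theorem discr_eq_of_roots {K : Type*} [Field K] [CharZero K] {g₂ g₃ a b c : K}
    (ha : 4 * a ^ 3 - g₂ * a - g₃ = 0) (hb : 4 * b ^ 3 - g₂ * b - g₃ = 0)
    (hc : 4 * c ^ 3 - g₂ * c - g₃ = 0) (hab : a ≠ b) (hac : a ≠ c) (hbc : b ≠ c) :
    g₂ ^ 3 - 27 * g₃ ^ 2 = 16 * ((a - b) * (a - c) * (b - c)) ^ 2 := by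
  have h1 : 4 * (a ^ 2 + a * b + b ^ 2) = g₂ := by
    apply mul_left_cancel₀ (sub_ne_zero.2 hab)
    linear_combination ha - hb
  have h2 : 4 * (a ^ 2 + a * c + c ^ 2) = g₂ := by
    apply mul_left_cancel₀ (sub_ne_zero.2 hac)
    linear_combination ha - hc
  have h3 : a + b + c = 0 := by
    apply mul_left_cancel₀ (sub_ne_zero.2 hbc)
    linear_combination (h1 - h2) / 4
  obtain rfl : c = -a - b := by linear_combination h3
  have h4 : g₃ = 4 * a ^ 3 - g₂ * a := by linear_combination -ha
  subst h4
  subst h1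
  ring

theorem weierstrassP_cubic_eq_zero {z : ℂ} (hz : z ∉ L.lattice) (hz' : 2 * z ∈ L.lattice) :
    4 * L.weierstrassP z ^ 3 - L.g₂ * L.weierstrassP z - L.g₃ = 0 := by
  rw [← L.derivWeierstrassP_sq z hz, derivWeierstrassP_eq_zero_of_two_mul_mem hz']
  ring

/-- The discriminant in terms of the values of `℘` at the half-periods, which are distinct. -/
theorem discr_eq (L : PeriodPair) :
    L.weierstrassP (L.ω₁ / 2) ≠ L.weierstrassP (L.ω₂ / 2) ∧
    L.weierstrassP (L.ω₁ / 2) ≠ L.weierstrassP ((L.ω₁ + L.ω₂) / 2) ∧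
    L.weierstrassP (L.ω₂ / 2) ≠ L.weierstrassP ((L.ω₁ + L.ω₂) / 2) ∧
    L.g₂ ^ 3 - 27 * L.g₃ ^ 2 = 16 * ((L.weierstrassP (L.ω₁ / 2) - L.weierstrassP (L.ω₂ / 2)) *
      (L.weierstrassP (L.ω₁ / 2) - L.weierstrassP ((L.ω₁ + L.ω₂) / 2)) *
      (L.weierstrassP (L.ω₂ / 2) - L.weierstrassP ((L.ω₁ + L.ω₂) / 2))) ^ 2 := by
  have h1 := L.ω₁_div_two_notMem_lattice
  have h2 := L.ω₂_div_two_notMem_lattice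
  have h3 := L.half_ω₁_add_half_ω₂_notMem_lattice
  have h1' : 2 * (L.ω₁ / 2) ∈ L.lattice := by
    rw [mul_div_cancel₀ _ two_ne_zero]; exact L.ω₁_mem_lattice
  have h2' : 2 * (L.ω₂ / 2) ∈ L.lattice := by
    rw [mul_div_cancel₀ _ two_ne_zero]; exact L.ω₂_mem_lattice
  have h3' : 2 * ((L.ω₁ + L.ω₂) / 2) ∈ L.lattice := by
    rw [mul_div_cancel₀ _ two_ne_zero]; exact add_mem L.ω₁_mem_lattice L.ω₂_mem_lattice
  have h12 := weierstrassP_ne_of_two_mul_mem h1 h2 h1' h2' (by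
    rw [← sub_div]; exact L.half_ω₁_sub_half_ω₂_notMem_lattice)
  have h13 := weierstrassP_ne_of_two_mul_mem h1 h3 h1' h3' (by
    rw [← sub_div, sub_add_cancel_left, neg_div, neg_mem_iff]; exact h2)
  have h23 := weierstrassP_ne_of_two_mul_mem h2 h3 h2' h3' (by
    rw [← sub_div, sub_add_cancel_right, neg_div, neg_mem_iff]; exact h1)
  exact ⟨h12, h13, h23, discr_eq_of_roots (weierstrassP_cubic_eq_zero h1 h1')
    (weierstrassP_cubic_eq_zero h2 h2') (weierstrassP_cubic_eq_zero h3 h3') h12 h13 h23⟩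

end PeriodPair

/-! ### Lattices with prescribed real invariants -/

namespace PeriodPair

open ComplexConjugate

/-- The lattice spanned by `c v i` and `u + (c - 1) v i`: it is rectangular if `c = 1` and rhombic
if `c = 2`. -/
def diagonalPair (c : ℤ) (hc : c ≠ 0) (u v : ℝ) (hu : u ≠ 0) (hv : v ≠ 0) : PeriodPair where
  ω₁ := c * v * Complex.I
  ω₂ := u + (c - 1) * v * Complex.I
  indep := by
    refine LinearIndependent.pair_iff.2 fun s t hst => ?_
    have hre := congrArg Complex.re hst
    have him := congrArg Complex.im hst
    simp [hu] at hre
    subst hre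
    simp [hv, hc] at him
    exact ⟨him, rfl⟩

/-- Index set for the lattice spanned by `c v i` and `u + (c - 1) v i`. -/
def diagonalIndex (c : ℤ) : Set (ℤ × ℤ) := {p | c ∣ p.1 + p.2}

/-- In these coordinates the condition c ∣ a + b is visibly invariant, for c ∣ 2, under sign changes
and exchange of a and b; a period basis hides this symmetry. -/
theorem mem_lattice_diagonalPair {c : ℤ} (hc : c ≠ 0) {u v : ℝ} (hu : u ≠ 0) (hv : v ≠ 0) {z : ℂ} :
    z ∈ (diagonalPair c hc u v hu hv).lattice ↔
      ∃ p ∈ diagonalIndex c, (p.1 * u + p.2 * v * Complex.I : ℂ) = z := by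
  rw [mem_lattice]
  constructor
  · rintro ⟨m, n, rfl⟩
    refine ⟨(n, m * c + n * (c - 1)), ⟨m + n, by simp; ring⟩, ?_⟩
    simp [diagonalPair]
    ring
  · rintro ⟨⟨a, b⟩, ⟨k, hk⟩, rfl⟩
    obtain rfl : b = c * k - a := by simp at hk; linarith
    refine ⟨k - a, a, ?_⟩
    simp [diagonalPair]
    ring

/-- The Eisenstein sum of the lattice of all `a + b y i` with `(a, b)` in `S`. -/
noncomputable def eisensteinSum (S : Set (ℤ × ℤ)) (k : ℕ) (y : ℝ) : ℂ :=
  ∑' p : S, ((p.1.1 + p.1.2 * y * Complex.I : ℂ) ^ k)⁻¹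

theorem injective_add_mul_I {u v : ℝ} (hu : u ≠ 0) (hv : v ≠ 0) :
    Function.Injective fun p : ℤ × ℤ => (p.1 * u + p.2 * v * Complex.I : ℂ) := by
  rintro ⟨a, b⟩ ⟨a', b'⟩ h
  have hre := congrArg Complex.re h
  have him := congrArg Complex.im h
  simp [hu] at hre
  simp [hv] at him
  simp [hre, him]

/-- Homogeneity of Eisenstein sums separates the size u from the shape v/u. -/
theorem G_diagonalPair {c : ℤ} (hc : c ≠ 0) {u v : ℝ} (hu : u ≠ 0) (hv : v ≠ 0) (k : ℕ) :
    (diagonalPair c hc u v hu hv).G k = ((u : ℂ) ^ k)⁻¹ * eisensteinSum (diagonalIndex c) k (v / u) := by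
  have hmem : ∀ p : diagonalIndex c, (p.1.1 * u + p.1.2 * v * Complex.I : ℂ) ∈
      (diagonalPair c hc u v hu hv).lattice := fun p =>
    (mem_lattice_diagonalPair hc hu hv).2 ⟨p.1, p.2, rfl⟩
  have hbij : Function.Bijective fun p : diagonalIndex c =>
      (⟨_, hmem p⟩ : (diagonalPair c hc u v hu hv).lattice) := by
    constructor
    · intro p q h
      exact Subtype.ext (injective_add_mul_I hu hv (congrArg Subtype.val h))
    · rintro ⟨z, hz⟩
      obtain ⟨p, hp, rfl⟩ := (mem_lattice_diagonalPair hc hu hv).1 hz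
      exact ⟨⟨p, hp⟩, rfl⟩
  rw [G, eisensteinSum, ← tsum_mul_left, ← (Equiv.ofBijective _ hbij).tsum_eq]
  refine tsum_congr fun p => ?_
  have hu' : (u : ℂ) ≠ 0 := by exact_mod_cast hu
  simp only [Equiv.ofBijective_apply, Complex.ofReal_div]
  rw [← mul_inv, ← mul_pow]
  congr 2
  field_simp

theorem summable_norm_eisensteinSum (S : Set (ℤ × ℤ)) {k : ℕ} (hk : 2 < k) {y : ℝ} (hy : y ≠ 0) :
    Summable fun p : S => ‖((p.1.1 + p.1.2 * y * Complex.I : ℂ) ^ k)⁻¹‖ := by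
  set L := diagonalPair 1 one_ne_zero 1 y one_ne_zero hy with hL
  have hmem : ∀ p : S, (p.1.1 * (1 : ℝ) + p.1.2 * y * Complex.I : ℂ) ∈ L.lattice := fun p =>
    (mem_lattice_diagonalPair one_ne_zero one_ne_zero hy).2 ⟨p.1, one_dvd _, rfl⟩
  have h := (ZLattice.summable_norm_pow_inv L.lattice k (by simpa using hk)).comp_injective
    (i := fun p : S => (⟨_, hmem p⟩ : L.lattice)) (fun p q h =>
      Subtype.ext (injective_add_mul_I one_ne_zero hy (congrArg Subtype.val h)))
  refine h.congr fun p => ?_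
  simp

/-- |a + byi|² = a² + b²y² grows with y > 0. This one domination yields both continuity in y and the
limit at infinity. -/
theorem norm_eisenstein_term_le (k : ℕ) {y₀ y : ℝ} (hy₀ : 0 < y₀) (hy : y₀ ≤ y) (p : ℤ × ℤ) :
    ‖((p.1 + p.2 * y * Complex.I : ℂ) ^ k)⁻¹‖ ≤ ‖((p.1 + p.2 * y₀ * Complex.I : ℂ) ^ k)⁻¹‖ := by
  rcases eq_or_ne p 0 with rfl | hp
  · simp
  have hne : (p.1 + p.2 * y₀ * Complex.I : ℂ) ≠ 0 := fun h => hp (by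
    have := injective_add_mul_I (u := 1) (v := y₀) one_ne_zero hy₀.ne' (a₁ := p) (a₂ := 0)
    exact this (by simpa using h))
  rw [norm_inv, norm_inv, norm_pow, norm_pow]
  gcongr
  have hn : ∀ x : ℝ, ‖(p.1 + p.2 * x * Complex.I : ℂ)‖ = √((p.1 : ℝ) ^ 2 + ((p.2 : ℝ) * x) ^ 2) := by
    intro x
    have := Complex.norm_add_mul_I (p.1 : ℝ) (p.2 * x)
    push_cast at this
    exact this
  rw [hn, hn, mul_pow, mul_pow]
  gcongr

theorem continuousOn_eisensteinSum (S : Set (ℤ × ℤ)) {k : ℕ} (hk : 2 < k) :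
    ContinuousOn (eisensteinSum S k) (Ioi 0) := by
  intro y₁ hy₁
  have hy₀ : 0 < y₁ / 2 := half_pos hy₁
  have : ContinuousOn (eisensteinSum S k) (Ici (y₁ / 2)) := by
    refine continuousOn_tsum (fun p => ?_) (summable_norm_eisensteinSum S hk hy₀.ne')
      fun p y hy => norm_eisenstein_term_le k hy₀ hy p
    rcases eq_or_ne p.1 0 with hp | hp
    · simp only [hp]
      simpa using continuousOn_const
    · refine ContinuousOn.inv₀ (by fun_prop) fun y hy => pow_ne_zero _ fun h => hp ?_
      have := injective_add_mul_I (u := 1) (v := y) one_ne_zero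
        (hy₀.trans_le hy).ne' (a₁ := p) (a₂ := 0)
      exact this (by simpa using h)
  exact (this.continuousAt (Ici_mem_nhds (half_lt_self hy₁))).continuousWithinAt

/-- Only lattice points on the real axis survive as the lattice is stretched vertically. -/
theorem tendsto_eisensteinSum (S : Set (ℤ × ℤ)) {k : ℕ} (hk : 2 < k) :
    Tendsto (eisensteinSum S k) atTop
      (𝓝 (∑' p : S, if p.1.2 = 0 then ((p.1.1 : ℂ) ^ k)⁻¹ else 0)) := by
  refine tendsto_tsum_of_dominated_convergence
    (summable_norm_eisensteinSum S hk one_ne_zero) (fun p => ?_) ?_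
  · split_ifs with hp
    · simp [hp]
    · have hp' : (p.1.2 : ℝ) ≠ 0 := by exact_mod_cast hp
      rw [tendsto_zero_iff_norm_tendsto_zero]
      simp only [norm_inv, norm_pow]
      refine Tendsto.inv_tendsto_atTop ((tendsto_pow_atTop (by lia)).comp ?_)
      refine tendsto_atTop_mono (fun y => Complex.abs_im_le_norm _) ?_
      simp only [Complex.add_im, Complex.intCast_im, zero_add, Complex.mul_im, Complex.I_im,
        Complex.I_re, mul_zero, mul_one, Complex.mul_re, Complex.intCast_re, Complex.ofReal_re,
        Complex.ofReal_im, zero_mul, sub_zero, add_zero, abs_mul]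
      exact tendsto_abs_atTop_atTop.const_mul_atTop (abs_pos.2 hp')
  · filter_upwards [eventually_ge_atTop 1] with y hy p
    exact norm_eisenstein_term_le k one_pos hy p

theorem hasSum_int_zeta {k : ℕ} (hk : Even k) (hk0 : k ≠ 0) {s : ℝ}
    (hs : HasSum (fun n : ℕ => 1 / (n : ℝ) ^ k) s) :
    HasSum (fun n : ℤ => ((n : ℂ) ^ k)⁻¹) ((2 * s : ℝ) : ℂ) := by
  have h1 : HasSum (fun n : ℕ => 1 / ((n + 1 : ℕ) : ℝ) ^ k) s := by
    have := (hasSum_nat_add_iff' 1).2 hs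
    simpa [hk0] using this
  have h2 : HasSum (fun n : ℕ => (((n : ℂ) + 1) ^ k)⁻¹) (s : ℂ) := by
    have := Complex.hasSum_ofReal.2 h1
    simpa using this
  have h3 := HasSum.of_add_one_of_neg_add_one (f := fun n : ℤ => ((n : ℂ) ^ k)⁻¹)
    (m := (s : ℂ)) (m' := s) (by simpa using h2) (by
      convert h2 using 3 with n
      push_cast
      rw [hk.neg_pow])
  convert h3 using 1
  simp [hk0]
  ring

theorem tsum_diagonalIndex_axis {c : ℤ} (hc : c ≠ 0) {k : ℕ} (hk : Even k) (hk0 : k ≠ 0) {s : ℝ}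
    (hs : HasSum (fun n : ℕ => 1 / (n : ℝ) ^ k) s) :
    (∑' p : diagonalIndex c, if p.1.2 = 0 then ((p.1.1 : ℂ) ^ k)⁻¹ else 0) =
      (((c : ℝ) ^ k)⁻¹ * (2 * s) : ℝ) := by
  have hinj : Function.Injective fun j : ℤ =>
      (⟨(c * j, 0), by simp [diagonalIndex]⟩ : diagonalIndex c) := by
    intro i j h
    have := congrArg (fun q : diagonalIndex c => q.1.1) h
    simpa [hc] using this
  rw [← hinj.tsum_eq]
  · simp only [if_true, Int.cast_mul, mul_pow, mul_inv]
    rw [tsum_mul_left, (hasSum_int_zeta hk hk0 hs).tsum_eq]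
    push_cast
    ring
  · rintro ⟨⟨a, b⟩, hab⟩ hp
    simp only [Function.mem_support, ne_eq, ite_eq_right_iff, Classical.not_imp] at hp
    obtain ⟨rfl, -⟩ := hp
    obtain ⟨j, hj⟩ := hab
    exact ⟨j, Subtype.ext (Prod.ext (by simpa using hj.symm) rfl)⟩

theorem conj_eisensteinSum {c : ℤ} (hc : c ∣ 2) (k : ℕ) (y : ℝ) :
    conj (eisensteinSum (diagonalIndex c) k y) = eisensteinSum (diagonalIndex c) k y := by
  have hS : ∀ p : ℤ × ℤ, p ∈ diagonalIndex c ↔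
      (Equiv.prodCongr (Equiv.refl ℤ) (Equiv.neg ℤ)) p ∈ diagonalIndex c := by
    rintro ⟨a, b⟩
    simp only [diagonalIndex, mem_ofPred_eq, Equiv.prodCongr_apply, Prod.map, Equiv.refl_apply,
      Equiv.neg_apply]
    have : c ∣ 2 * b := hc.mul_right b
    rw [show a + b = a + -b + 2 * b by ring]
    exact (dvd_add_left this)
  rw [eisensteinSum, Complex.conj_tsum, ← (Equiv.subtypeEquiv _ hS).tsum_eq]
  refine tsum_congr fun p => ?_
  simp

/-- Rotation by a right angle: a + bi/y = (i/y)(b - ayi), and (a, b) ↦ (b, -a) preserves the index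
set. -/
theorem eisensteinSum_inv {c : ℤ} (hc : c ∣ 2) (k : ℕ) {y : ℝ} (hy : y ≠ 0) :
    eisensteinSum (diagonalIndex c) k y⁻¹ =
      (y / Complex.I) ^ k * eisensteinSum (diagonalIndex c) k y := by
  have hS : ∀ p : ℤ × ℤ, p ∈ diagonalIndex c ↔
      ((Equiv.prodComm ℤ ℤ).trans (Equiv.prodCongr (Equiv.refl ℤ) (Equiv.neg ℤ))) p ∈
        diagonalIndex c := by
    rintro ⟨a, b⟩
    simp only [diagonalIndex, mem_ofPred_eq, Equiv.trans_apply, Equiv.prodComm_apply, Prod.swap,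
      Equiv.prodCongr_apply, Prod.map, Equiv.refl_apply, Equiv.neg_apply]
    have : c ∣ 2 * a := hc.mul_right a
    rw [show a + b = b + -a + 2 * a by ring]
    exact (dvd_add_left this)
  rw [eisensteinSum, eisensteinSum, ← tsum_mul_left]
  refine Eq.trans ?_ ((Equiv.subtypeEquiv _ hS).tsum_eq _)
  refine tsum_congr fun p => ?_
  have hy' : (y : ℂ) ≠ 0 := by exact_mod_cast hy
  simp only [Equiv.subtypeEquiv_apply, Equiv.trans_apply, Equiv.prodComm_apply, Prod.swap,
    Equiv.prodCongr_apply, Prod.map, Equiv.refl_apply, Equiv.neg_apply]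
  rw [← inv_inv ((y / Complex.I : ℂ) ^ k), ← mul_inv, ← inv_pow (y / Complex.I : ℂ), ← mul_pow, inv_div]
  congr 2
  push_cast
  field_simp
  linear_combination (p.1.1 * y : ℂ) * Complex.I_sq

theorem exists_re_eisensteinSum {c : ℤ} (hc : c ∣ 2) (k : ℕ) (y : ℝ) :
    eisensteinSum (diagonalIndex c) k y = ((eisensteinSum (diagonalIndex c) k y).re : ℂ) :=
  (Complex.conj_eq_iff_re.1 (conj_eisensteinSum hc k y)).symm

/-- The real invariant `g₂` of the lattice spanned by `c y i` and `1 + (c - 1) y i`. -/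
noncomputable def diagonalG₂ (c : ℤ) (y : ℝ) : ℝ := 60 * (eisensteinSum (diagonalIndex c) 4 y).re

/-- The real invariant `g₃` of the lattice spanned by `c y i` and `1 + (c - 1) y i`. -/
noncomputable def diagonalG₃ (c : ℤ) (y : ℝ) : ℝ := 140 * (eisensteinSum (diagonalIndex c) 6 y).re

theorem g₂_diagonalPair {c : ℤ} (hc : c ≠ 0) (hc2 : c ∣ 2) {u v : ℝ} (hu : u ≠ 0) (hv : v ≠ 0) :
    (diagonalPair c hc u v hu hv).g₂ = ((u ^ 4)⁻¹ * diagonalG₂ c (v / u) : ℝ) := by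
  rw [g₂, G_diagonalPair, exists_re_eisensteinSum hc2, diagonalG₂]
  push_cast
  ring

theorem g₃_diagonalPair {c : ℤ} (hc : c ≠ 0) (hc2 : c ∣ 2) {u v : ℝ} (hu : u ≠ 0) (hv : v ≠ 0) :
    (diagonalPair c hc u v hu hv).g₃ = ((u ^ 6)⁻¹ * diagonalG₃ c (v / u) : ℝ) := by
  rw [g₃, G_diagonalPair, exists_re_eisensteinSum hc2, diagonalG₃]
  push_cast
  ring

theorem diagonalG₂_inv {c : ℤ} (hc : c ∣ 2) {y : ℝ} (hy : y ≠ 0) :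
    diagonalG₂ c y⁻¹ = y ^ 4 * diagonalG₂ c y := by
  have h := eisensteinSum_inv hc 4 hy
  rw [exists_re_eisensteinSum hc 4 y, div_pow, Complex.I_pow_four, div_one] at h
  rw [diagonalG₂, diagonalG₂, h]
  norm_cast
  ring

/-- The sign comes from i⁶ = -1 and lets g₃ take both signs within one family. -/
theorem diagonalG₃_inv {c : ℤ} (hc : c ∣ 2) {y : ℝ} (hy : y ≠ 0) :
    diagonalG₃ c y⁻¹ = -(y ^ 6 * diagonalG₃ c y) := by
  have h := eisensteinSum_inv hc 6 hy
  have h6 : Complex.I ^ 6 = -1 := by linear_combination (Complex.I ^ 4 - Complex.I ^ 2 + 1) * Complex.I_sq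
  rw [exists_re_eisensteinSum hc 6 y, div_pow, h6, div_neg, div_one] at h
  rw [diagonalG₃, diagonalG₃, h]
  norm_cast
  ring

theorem continuousOn_diagonalG₂ (c : ℤ) : ContinuousOn (diagonalG₂ c) (Ioi 0) :=
  continuousOn_const.mul (Complex.continuous_re.comp_continuousOn
    (continuousOn_eisensteinSum _ (by norm_num)))

theorem continuousOn_diagonalG₃ (c : ℤ) : ContinuousOn (diagonalG₃ c) (Ioi 0) :=
  continuousOn_const.mul (Complex.continuous_re.comp_continuousOn
    (continuousOn_eisensteinSum _ (by norm_num)))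

theorem hasSum_zeta_six : HasSum (fun n : ℕ => (1 : ℝ) / (n : ℝ) ^ 6) (Real.pi ^ 6 / 945) := by
  convert hasSum_zeta_nat (k := 3) (by norm_num) using 1
  rw [bernoulli_eq_bernoulli'_of_ne_one (by decide)]
  have : bernoulli' 6 = 1 / 42 := by
    rw [bernoulli'_def]
    simp [Finset.sum_range_succ, bernoulli'_eq_zero_of_odd (n := 5) (by decide) (by norm_num)]
    norm_num [Nat.choose]
  norm_num [this, Nat.factorial]
  ring

theorem tendsto_diagonalG₂ {c : ℤ} (hc : c ≠ 0) :
    Tendsto (diagonalG₂ c) atTop (𝓝 (60 * (((c : ℝ) ^ 4)⁻¹ * (2 * (Real.pi ^ 4 / 90))))) := by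
  have h := tendsto_eisensteinSum (diagonalIndex c) (k := 4) (by norm_num)
  rw [tsum_diagonalIndex_axis hc (by decide) (by norm_num) hasSum_zeta_four] at h
  have h' := (Complex.continuous_re.tendsto _).comp h
  rw [Complex.ofReal_re] at h'
  exact h'.const_mul 60

theorem tendsto_diagonalG₃ {c : ℤ} (hc : c ≠ 0) :
    Tendsto (diagonalG₃ c) atTop (𝓝 (140 * (((c : ℝ) ^ 6)⁻¹ * (2 * (Real.pi ^ 6 / 945))))) := by
  have h := tendsto_eisensteinSum (diagonalIndex c) (k := 6) (by norm_num)
  rw [tsum_diagonalIndex_axis hc (by decide) (by norm_num) hasSum_zeta_six] at h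
  have h' := (Complex.continuous_re.tendsto _).comp h
  rw [Complex.ofReal_re] at h'
  exact h'.const_mul 140

/-- The discriminant of the lattice spanned by `c y i` and `1 + (c - 1) y i`. -/
noncomputable def diagonalDiscr (c : ℤ) (y : ℝ) : ℝ := diagonalG₂ c y ^ 3 - 27 * diagonalG₃ c y ^ 2

/-- The lattice degenerates to rank one: by the values of ζ(4) and ζ(6), the limits of g₂ and g₃ are
(4/3)(π/c)⁴ and (8/27)(π/c)⁶, which satisfy g₂³ = 27g₃². -/
theorem tendsto_diagonalDiscr {c : ℤ} (hc : c ≠ 0) : Tendsto (diagonalDiscr c) atTop (𝓝 0) := by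
  have h := ((tendsto_diagonalG₂ hc).pow 3).sub (((tendsto_diagonalG₃ hc).pow 2).const_mul 27)
  have hlim : (60 * (((c : ℝ) ^ 4)⁻¹ * (2 * (Real.pi ^ 4 / 90)))) ^ 3 -
      27 * (140 * (((c : ℝ) ^ 6)⁻¹ * (2 * (Real.pi ^ 6 / 945)))) ^ 2 = 0 := by
    have : (c : ℝ) ≠ 0 := by exact_mod_cast hc
    field_simp
    norm_num
  rwa [hlim] at h

theorem diagonalDiscr_inv {c : ℤ} (hc : c ∣ 2) {y : ℝ} (hy : y ≠ 0) :
    diagonalDiscr c y⁻¹ = y ^ 12 * diagonalDiscr c y := by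
  rw [diagonalDiscr, diagonalG₂_inv hc hy, diagonalG₃_inv hc hy, diagonalDiscr]
  ring

theorem conj_mem_lattice_diagonalPair {c : ℤ} (hc : c ≠ 0) (hc2 : c ∣ 2) {u v : ℝ} (hu : u ≠ 0)
    (hv : v ≠ 0) : ∀ z ∈ (diagonalPair c hc u v hu hv).lattice,
      conj z ∈ (diagonalPair c hc u v hu hv).lattice := fun _ hz =>
  conj_mem_lattice (by rw [g₂_diagonalPair hc hc2, Complex.conj_ofReal])
    (by rw [g₃_diagonalPair hc hc2, Complex.conj_ofReal]) hz

theorem diagonalDiscr_eq {c : ℤ} (hc : c ≠ 0) (hc2 : c ∣ 2) {y : ℝ} (hy : y ≠ 0) :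
    ((diagonalDiscr c y : ℝ) : ℂ) = (diagonalPair c hc 1 y one_ne_zero hy).g₂ ^ 3 -
      27 * (diagonalPair c hc 1 y one_ne_zero hy).g₃ ^ 2 := by
  rw [g₂_diagonalPair hc hc2, g₃_diagonalPair hc hc2, diagonalDiscr]
  simp

/-- Rectangular lattices have positive discriminant. -/
theorem diagonalDiscr_one_pos {y : ℝ} (hy : y ≠ 0) : 0 < diagonalDiscr 1 y := by
  have hL := conj_mem_lattice_diagonalPair one_ne_zero (one_dvd 2) one_ne_zero hy
  have hD := diagonalDiscr_eq one_ne_zero (one_dvd 2) hy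
  set L := diagonalPair 1 one_ne_zero 1 y one_ne_zero hy with hLdef
  obtain ⟨h12, h13, h23, h⟩ := L.discr_eq
  have hω₁ : conj L.ω₁ = -L.ω₁ := by simp [hLdef, diagonalPair]
  have hω₂ : conj L.ω₂ = L.ω₂ := by simp [hLdef, diagonalPair]
  -- Each half-period is congruent to its conjugate, so all three roots are real and the
  -- discriminant is a nonzero real square.
  have hreal : ∀ z, z - conj z ∈ L.lattice → ∃ r : ℝ, L.weierstrassP z = r := fun z hz =>
    ⟨_, (Complex.conj_eq_iff_re.1 (Complex.conj_eq_iff_im.2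
      (im_weierstrassP_eq_zero hL hz).1)).symm⟩
  obtain ⟨a, ha⟩ := hreal (L.ω₁ / 2) (by
    rw [map_div₀, map_ofNat, hω₁]; convert L.ω₁_mem_lattice using 1; ring)
  obtain ⟨b, hb⟩ := hreal (L.ω₂ / 2) (by
    rw [map_div₀, map_ofNat, hω₂, sub_self]; exact zero_mem _)
  obtain ⟨d, hd⟩ := hreal ((L.ω₁ + L.ω₂) / 2) (by
    rw [map_div₀, map_ofNat, map_add, hω₁, hω₂]; convert L.ω₁_mem_lattice using 1; ring)
  rw [ha, hb] at h12
  rw [ha, hd] at h13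
  rw [hb, hd] at h23
  rw [← hD, ha, hb, hd] at h
  norm_cast at h h12 h13 h23
  rw [h]
  have : (a - b) * (a - d) * (b - d) ≠ 0 :=
    mul_ne_zero (mul_ne_zero (sub_ne_zero.2 h12) (sub_ne_zero.2 h13)) (sub_ne_zero.2 h23)
  positivity

/-- Rhombic lattices have negative discriminant. -/
theorem diagonalDiscr_two_neg {y : ℝ} (hy : y ≠ 0) : diagonalDiscr 2 y < 0 := by
  have hL := conj_mem_lattice_diagonalPair two_ne_zero (dvd_refl 2) one_ne_zero hy
  have hD := diagonalDiscr_eq two_ne_zero (dvd_refl 2) hy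
  set L := diagonalPair 2 two_ne_zero 1 y one_ne_zero hy with hLdef
  obtain ⟨h12, h13, h23, h⟩ := L.discr_eq
  have hω₁ : conj L.ω₁ = -L.ω₁ := by simp [hLdef, diagonalPair, map_ofNat (starRingEnd ℂ)]
  have hω₂ : conj L.ω₂ = L.ω₂ - L.ω₁ := by simp [hLdef, diagonalPair, map_ofNat (starRingEnd ℂ)]; ring
  have ha : conj (L.weierstrassP (L.ω₁ / 2)) = L.weierstrassP (L.ω₁ / 2) := by
    rw [← weierstrassP_conj hL, map_div₀, map_ofNat, hω₁, neg_div, weierstrassP_neg]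
  have hb : conj (L.weierstrassP (L.ω₂ / 2)) = L.weierstrassP ((L.ω₁ + L.ω₂) / 2) := by
    rw [← weierstrassP_conj hL, map_div₀, map_ofNat, hω₂,
      ← L.weierstrassP_add_coe _ ⟨_, L.ω₁_mem_lattice⟩]
    congr 1
    ring
  rw [← hb] at h13 h23 h
  set a := L.weierstrassP (L.ω₁ / 2)
  set b := L.weierstrassP (L.ω₂ / 2)
  set w := (a - b) * (a - conj b) * (b - conj b) with hw
  have hw0 : w ≠ 0 :=
    mul_ne_zero (mul_ne_zero (sub_ne_zero.2 h12) (sub_ne_zero.2 h13)) (sub_ne_zero.2 h23)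
  -- One root is real and the other two are conjugate, so the product of differences is imaginary
  -- and has negative square.
  have hwc : conj w = -w := by simp [hw, ha]; ring
  have hre : w.re = 0 := by
    have := congrArg Complex.re hwc
    simp at this
    linarith
  have him : w.im ≠ 0 := fun h0 => hw0 (Complex.ext hre h0)
  have h' := congrArg Complex.re (hD.trans h)
  simp [sq, hre] at h'
  rw [h']
  have := mul_self_pos.2 him
  linarith

/-- The family of lattices spanned by `c v i` and `u + (c - 1) v i` realises all real invariants for
which the discriminant has the sign prescribed by `c`. -/
theorem exists_diagonalPair {c : ℤ} (hc : 0 < c) (hc2 : c ∣ 2) {ε : ℝ}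
    (hε : ∀ y : ℝ, 0 < y → 0 < ε * diagonalDiscr c y) {a b : ℝ}
    (hab : 0 < ε * (a ^ 3 - 27 * b ^ 2)) :
    ∃ L : PeriodPair, L.g₂ = (a : ℂ) ∧ L.g₃ = (b : ℂ) ∧ L.ω₁.re = 0 := by
  -- Numerator and denominator both scale with weight 6, so ψ depends on the shape alone.
  set ψ : ℝ → ℝ := fun y => diagonalG₃ c y / √(ε * diagonalDiscr c y) with hψ
  have hψc : ContinuousOn ψ (Ioi 0) := by
    refine (continuousOn_diagonalG₃ c).div (ContinuousOn.sqrt (continuousOn_const.mul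
      (((continuousOn_diagonalG₂ c).pow 3).sub
        (continuousOn_const.mul ((continuousOn_diagonalG₃ c).pow 2))))) fun y hy => ?_
    exact (Real.sqrt_pos.2 (hε y hy)).ne'
  -- The numerator has a positive limit, while the denominator tends to 0 from above.
  have hψtop : Tendsto ψ atTop atTop := by
    have hpos : 0 < 140 * (((c : ℝ) ^ 6)⁻¹ * (2 * (Real.pi ^ 6 / 945))) := by
      have : (0 : ℝ) < c := by exact_mod_cast hc
      positivity
    refine Tendsto.pos_mul_atTop hpos (tendsto_diagonalG₃ hc.ne') ?_
    refine Tendsto.inv_tendsto_nhdsGT_zero (tendsto_nhdsWithin_iff.2 ⟨?_, ?_⟩)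
    · have := ((tendsto_diagonalDiscr hc.ne').const_mul ε).sqrt
      simpa using this
    · filter_upwards [eventually_gt_atTop 0] with y hy
      exact Real.sqrt_pos.2 (hε y hy)
  have hψinv : ∀ y : ℝ, 0 < y → ψ y⁻¹ = -ψ y := by
    intro y hy
    simp only [hψ]
    rw [diagonalG₃_inv hc2 hy.ne', diagonalDiscr_inv hc2 hy.ne',
      show ε * (y ^ 12 * diagonalDiscr c y) = (y ^ 6) ^ 2 * (ε * diagonalDiscr c y) by ring,
      Real.sqrt_mul (by positivity), Real.sqrt_sq (by positivity)]
    have := (Real.sqrt_pos.2 (hε y hy)).ne'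
    field_simp
  set β := b / √(ε * (a ^ 3 - 27 * b ^ 2)) with hβ
  obtain ⟨y₁, hy₁, hψ₁⟩ := ((eventually_gt_atTop 0).and (hψtop.eventually_ge_atTop |β|)).exists
  obtain ⟨y, hy, hyβ⟩ : ∃ y ∈ Ioi (0 : ℝ), ψ y = β := by
    refine isPreconnected_Ioi.intermediate_value (a := y₁⁻¹) (b := y₁) (inv_pos.2 hy₁) hy₁ hψc ?_
    rw [hψinv y₁ hy₁]
    exact ⟨by linarith [neg_abs_le β], (le_abs_self β).trans hψ₁⟩
  replace hy : 0 < y := hy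
  set D := ε * diagonalDiscr c y with hD
  have hDpos : 0 < D := hε y hy
  set D' := ε * (a ^ 3 - 27 * b ^ 2) with hD'
  -- The discriminant has weight 12; this u matches it. Then ψ y = β gives g₃, and g₂ follows
  -- because real cubes are injective.
  obtain ⟨u, hu, hu12⟩ : ∃ u : ℝ, 0 < u ∧ u ^ 12 = D / D' :=
    ⟨(D / D') ^ ((12 : ℕ) : ℝ)⁻¹, by positivity, Real.rpow_inv_natCast_pow (by positivity) (by norm_num)⟩
  have hε0 : ε ≠ 0 := fun h => by simp [hD', h] at hab
  have hu6 : u ^ 6 * √D' = √D := by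
    rw [← Real.sqrt_sq (show 0 ≤ u ^ 6 by positivity), ← Real.sqrt_mul (by positivity), ← pow_mul,
      hu12, div_mul_cancel₀ _ hab.ne']
  have hb : (u ^ 6)⁻¹ * diagonalG₃ c y = b := by
    have h1 : diagonalG₃ c y = β * √D := by
      rw [← hyβ]; exact (div_mul_cancel₀ _ (Real.sqrt_pos.2 hDpos).ne').symm
    rw [h1, ← hu6, hβ]
    have := (Real.sqrt_pos.2 hab).ne'
    field_simp
  have ha : (u ^ 4)⁻¹ * diagonalG₂ c y = a := by
    have hodd : Odd 3 := by decide
    refine hodd.pow_injective (R := ℝ) ?_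
    have h1 : u ^ 12 * (a ^ 3 - 27 * b ^ 2) = diagonalDiscr c y := by
      apply mul_left_cancel₀ hε0
      rw [← hD, mul_left_comm, ← hD', hu12, div_mul_cancel₀ _ hab.ne']
    rw [diagonalDiscr] at h1
    have h2 : diagonalG₃ c y = u ^ 6 * b := by rw [← hb]; field_simp
    rw [h2] at h1
    simp only [mul_pow, inv_pow]
    field_simp
    linear_combination -h1
  refine ⟨diagonalPair c hc.ne' u (y * u) hu.ne' (by positivity), ?_, ?_, ?_⟩
  · rw [g₂_diagonalPair hc.ne' hc2, mul_div_cancel_right₀ _ hu.ne', ha]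
  · rw [g₃_diagonalPair hc.ne' hc2, mul_div_cancel_right₀ _ hu.ne', hb]
  · simp [diagonalPair]

/-- All real invariants with nonzero discriminant belong to a lattice with a `ℤ`-basis whose first
member is purely imaginary. -/
theorem exists_of_real_invariants {a b : ℝ} (h : a ^ 3 - 27 * b ^ 2 ≠ 0) :
    ∃ L : PeriodPair, L.g₂ = (a : ℂ) ∧ L.g₃ = (b : ℂ) ∧ L.ω₁.re = 0 := by
  rcases h.lt_or_gt with h | h
  · exact exists_diagonalPair (c := 2) (ε := -1) two_pos (dvd_refl 2)
      (fun y hy => by linarith [diagonalDiscr_two_neg hy.ne']) (by linarith)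
  · exact exists_diagonalPair (c := 1) (ε := 1) one_pos (one_dvd 2)
      (fun y hy => by linarith [diagonalDiscr_one_pos hy.ne']) (by linarith)

end PeriodPair

/-! ### Hamilton's equations and their reduction to x and ξ -/

theorem isHamiltonTrajectory_p4_iff {h : ℝ} {I : Set ℝ} {x y ξ η : ℝ → ℝ} :
    IsHamiltonTrajectory (p4 h) I x y ξ η ↔
      ∀ t ∈ I, HasDerivAt x (x t * ξ t) t ∧ HasDerivAt y (x t * η t) t ∧
        HasDerivAt ξ (-(x t) ^ 2 - 1 / 2 * (x t ^ 2 + y t ^ 2 + ξ t ^ 2 + η t ^ 2) + 5 / 2 * h) t ∧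
        HasDerivAt η (-(x t * y t)) t := by
  have hxi : ∀ a b c d : ℝ, deriv (fun s => p4 h a b s d) c = a * c := fun a b c d => by
    simp only [p4]
    refine HasDerivAt.deriv ?_
    have := ((((hasDerivAt_pow 2 c).const_add (a ^ 2 + b ^ 2)).add_const (d ^ 2)).const_mul
      (1 / 2 * a)).sub_const (5 / 2 * h * a)
    refine this.congr_deriv ?_
    push_cast
    ring
  have heta : ∀ a b c d : ℝ, deriv (fun s => p4 h a b c s) d = a * d := fun a b c d => by
    simp only [p4]
    refine HasDerivAt.deriv ?_
    have := (((hasDerivAt_pow 2 d).const_add (a ^ 2 + b ^ 2 + c ^ 2)).const_mul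
      (1 / 2 * a)).sub_const (5 / 2 * h * a)
    refine this.congr_deriv ?_
    push_cast
    ring
  have hy : ∀ a b c d : ℝ, deriv (fun s => p4 h a s c d) b = a * b := fun a b c d => by
    simp only [p4]
    refine HasDerivAt.deriv ?_
    have := (((((hasDerivAt_pow 2 b).const_add (a ^ 2)).add_const (c ^ 2)).add_const
      (d ^ 2)).const_mul (1 / 2 * a)).sub_const (5 / 2 * h * a)
    refine this.congr_deriv ?_
    push_cast
    ring
  have hx : ∀ a b c d : ℝ, -deriv (fun s => p4 h s b c d) a =
      -a ^ 2 - 1 / 2 * (a ^ 2 + b ^ 2 + c ^ 2 + d ^ 2) + 5 / 2 * h := fun a b c d => by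
    simp only [p4]
    rw [neg_eq_iff_eq_neg]
    refine HasDerivAt.deriv ?_
    have := (((hasDerivAt_id' a).const_mul (1 / 2)).mul ((((hasDerivAt_pow 2 a).add_const
      (b ^ 2)).add_const (c ^ 2)).add_const (d ^ 2))).sub ((hasDerivAt_id' a).const_mul (5 / 2 * h))
    refine this.congr_deriv ?_
    push_cast
    ring
  constructor
  · intro H t ht
    refine ⟨?_, ?_, ?_, ?_⟩
    · simpa only [hxi] using H.dx t ht
    · simpa only [heta] using H.dy t ht
    · simpa only [hx] using H.dξ t ht
    · simpa only [hy] using H.dη t ht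
  · intro H
    refine ⟨fun t ht => ?_, fun t ht => ?_, fun t ht => ?_, fun t ht => ?_⟩
    · simpa only [hxi] using (H t ht).1
    · simpa only [heta] using (H t ht).2.1
    · simpa only [hx] using (H t ht).2.2.1
    · simpa only [hy] using (H t ht).2.2.2

namespace IsTimeInterval

variable {I : Set ℝ} (hI : IsTimeInterval I)

include hI

theorem isPreconnected : IsPreconnected I := hI.ordConnected.isPreconnected

theorem eq_of_hasDerivAt_zero {f : ℝ → ℝ} (hf : ∀ t ∈ I, HasDerivAt f 0 t) {t : ℝ} (ht : t ∈ I) :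
    f t = f 0 :=
  hI.isOpen.is_const_of_deriv_eq_zero hI.isPreconnected
    (fun s hs => (hf s hs).differentiableAt.differentiableWithinAt) (fun s hs => (hf s hs).deriv)
    ht hI.zero_mem

theorem uIcc_subset {t : ℝ} (ht : t ∈ I) : uIcc 0 t ⊆ I := hI.ordConnected.uIcc_subset hI.zero_mem ht

theorem hasDerivAt_integral {x : ℝ → ℝ} (hx : ContinuousOn x I) {t : ℝ} (ht : t ∈ I) :
    HasDerivAt (fun u => ∫ s in (0 : ℝ)..u, x s) (x t) t :=
  intervalIntegral.integral_hasDerivAt_right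
    ((hx.mono (hI.uIcc_subset ht)).intervalIntegrable)
    (hx.stronglyMeasurableAtFilter hI.isOpen t ht) (hx.continuousAt (hI.isOpen.mem_nhds ht))

theorem integral_eq_zero {x : ℝ → ℝ} (hx : ∀ t ∈ I, x t = 0) {t : ℝ} (ht : t ∈ I) :
    ∫ s in (0 : ℝ)..t, x s = 0 := by
  rw [intervalIntegral.integral_congr (g := fun _ => 0) fun s hs => hx s (hI.uIcc_subset ht hs)]
  simp

/-- The equations for `y` and `η` say that `(y, η)` is rotated by the angle `∫ x`. -/
theorem rotatesBy_iff {x y η : ℝ → ℝ} (hx : ContinuousOn x I) :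
    RotatesBy I x y η ↔
      ∀ t ∈ I, HasDerivAt y (x t * η t) t ∧ HasDerivAt η (-(x t * y t)) t := by
  have hθ := fun t ht => hI.hasDerivAt_integral hx (t := t) ht
  constructor
  · intro H t ht
    have hev : ∀ᶠ s in 𝓝 t, s ∈ I := hI.isOpen.mem_nhds ht
    have h1 := (((hθ t ht).cos.const_mul (y 0)).add ((hθ t ht).sin.const_mul (η 0)))
    have h2 := (((hθ t ht).sin.const_mul (-(y 0))).add ((hθ t ht).cos.const_mul (η 0)))
    constructor
    · refine (h1.congr_of_eventuallyEq (hev.mono fun s hs => (H s hs).1)).congr_deriv ?_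
      rw [(H t ht).2]
      ring
    · refine (h2.congr_of_eventuallyEq (hev.mono fun s hs => (H s hs).2)).congr_deriv ?_
      rw [(H t ht).1]
      ring
  · intro H t ht
    -- Rotating (y, η) back by the angle gives two constants of the motion.
    have h1 := hI.eq_of_hasDerivAt_zero (f := fun t => y t * Real.cos (∫ s in (0 : ℝ)..t, x s) -
      η t * Real.sin (∫ s in (0 : ℝ)..t, x s)) (fun t ht => by
        refine (((H t ht).1.mul (hθ t ht).cos).sub ((H t ht).2.mul (hθ t ht).sin)).congr_deriv ?_
        ring) ht
    have h2 := hI.eq_of_hasDerivAt_zero (f := fun t => y t * Real.sin (∫ s in (0 : ℝ)..t, x s) +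
      η t * Real.cos (∫ s in (0 : ℝ)..t, x s)) (fun t ht => by
        refine (((H t ht).1.mul (hθ t ht).sin).add ((H t ht).2.mul (hθ t ht).cos)).congr_deriv ?_
        ring) ht
    simp only [intervalIntegral.integral_same, Real.cos_zero, Real.sin_zero, mul_one, mul_zero,
      sub_zero, zero_add] at h1 h2
    have h3 := Real.sin_sq_add_cos_sq (∫ s in (0 : ℝ)..t, x s)
    set S := Real.sin (∫ s in (0 : ℝ)..t, x s)
    set C := Real.cos (∫ s in (0 : ℝ)..t, x s)
    rw [← h1, ← h2]
    constructor
    · linear_combination -(y t) * h3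
    · linear_combination -(η t) * h3

theorem staysAtZero_iff {x y η : ℝ → ℝ} :
    StaysAtZero I x y η ↔ (∀ t ∈ I, x t = 0) ∧ RotatesBy I x y η := by
  constructor
  · intro H
    have hx : ∀ t ∈ I, x t = 0 := fun t ht => (H t ht).1
    exact ⟨hx, fun t ht => by simpa [hI.integral_eq_zero hx ht] using (H t ht).2⟩
  · rintro ⟨hx, H⟩ t ht
    refine ⟨hx t ht, ?_⟩
    simpa [hI.integral_eq_zero hx ht] using H t ht

end IsTimeInterval

theorem RotatesBy.sq_add_sq {I : Set ℝ} {x y η : ℝ → ℝ} (H : RotatesBy I x y η) {t : ℝ}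
    (ht : t ∈ I) : y t ^ 2 + η t ^ 2 = y 0 ^ 2 + η 0 ^ 2 := by
  rw [(H t ht).1, (H t ht).2]
  linear_combination (y 0 ^ 2 + η 0 ^ 2) * Real.sin_sq_add_cos_sq (∫ s in (0 : ℝ)..t, x s)

/-- The equations for `x` and `ξ` alone, with `α = y² + η² - 5h`. -/
def IsReducedTrajectory (α : ℝ) (I : Set ℝ) (x ξ : ℝ → ℝ) : Prop :=
  ∀ t ∈ I, HasDerivAt x (x t * ξ t) t ∧
    HasDerivAt ξ (-(3 * x t ^ 2 + ξ t ^ 2 + α) / 2) t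

theorem IsReducedTrajectory.continuousOn {α : ℝ} {I : Set ℝ} {x ξ : ℝ → ℝ}
    (H : IsReducedTrajectory α I x ξ) : ContinuousOn x I :=
  fun t ht => (H t ht).1.continuousAt.continuousWithinAt

/-- A rotation preserves y² + η², so its initial value C₁² may be substituted into the ξ-equation at
every time, in both directions. -/
theorem isHamiltonTrajectory_iff_isReducedTrajectory {h C₁ α : ℝ} (hα : α = C₁ ^ 2 - 5 * h)
    {I : Set ℝ} (hI : IsTimeInterval I) {x y ξ η : ℝ → ℝ} (h₀ : y 0 ^ 2 + η 0 ^ 2 = C₁ ^ 2) :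
    IsHamiltonTrajectory (p4 h) I x y ξ η ↔
      IsReducedTrajectory α I x ξ ∧ RotatesBy I x y η := by
  rw [isHamiltonTrajectory_p4_iff]
  constructor
  · intro H
    have hx : ContinuousOn x I := fun t ht => (H t ht).1.continuousAt.continuousWithinAt
    have hR : RotatesBy I x y η := (hI.rotatesBy_iff hx).2 fun t ht =>
      ⟨(H t ht).2.1, (H t ht).2.2.2⟩
    refine ⟨fun t ht => ⟨(H t ht).1, (H t ht).2.2.1.congr_deriv ?_⟩, hR⟩
    have := hR.sq_add_sq ht
    linear_combination hα / 2 - (1 / 2) * this - (1 / 2) * h₀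
  · rintro ⟨H, hR⟩ t ht
    have hyη := (hI.rotatesBy_iff H.continuousOn).1 hR t ht
    refine ⟨(H t ht).1, hyη.1, (H t ht).2.congr_deriv ?_, hyη.2⟩
    have := hR.sq_add_sq ht
    linear_combination -hα / 2 + (1 / 2) * this + (1 / 2) * h₀

theorem p4_eq_of_sq_add_sq {h C₁ α x y ξ η : ℝ} (hα : α = C₁ ^ 2 - 5 * h)
    (hC : y ^ 2 + η ^ 2 = C₁ ^ 2) : p4 h x y ξ η = x * (x ^ 2 + ξ ^ 2 + α) / 2 := by
  rw [p4]
  linear_combination (1 / 2 * x) * hC - (1 / 2 * x) * hα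

theorem IsReducedTrajectory.energy_eq {α : ℝ} {I : Set ℝ} (hI : IsTimeInterval I) {x ξ : ℝ → ℝ}
    (H : IsReducedTrajectory α I x ξ) {t : ℝ} (ht : t ∈ I) :
    x t * (x t ^ 2 + ξ t ^ 2 + α) / 2 = x 0 * (x 0 ^ 2 + ξ 0 ^ 2 + α) / 2 := by
  refine hI.eq_of_hasDerivAt_zero (f := fun t => x t * (x t ^ 2 + ξ t ^ 2 + α) / 2)
    (fun s hs => ?_) ht
  obtain ⟨h1, h2⟩ := H s hs
  refine ((h1.mul (((h1.pow 2).add (h2.pow 2)).add_const α)).div_const 2).congr_deriv ?_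
  simp
  ring

/-- The equation for x is linear in x; hence x vanishes identically once x(0) = 0. -/
theorem IsReducedTrajectory.eq_mul_exp_integral {α : ℝ} {I : Set ℝ} (hI : IsTimeInterval I)
    {x ξ : ℝ → ℝ} (H : IsReducedTrajectory α I x ξ) {t : ℝ} (ht : t ∈ I) :
    x t = x 0 * Real.exp (∫ s in (0 : ℝ)..t, ξ s) := by
  have hξ : ContinuousOn ξ I := fun t ht => (H t ht).2.continuousAt.continuousWithinAt
  have h1 := hI.eq_of_hasDerivAt_zero (f := fun t => x t * Real.exp (-∫ s in (0 : ℝ)..t, ξ s))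
    (fun t ht => by
      refine ((H t ht).1.mul (hI.hasDerivAt_integral hξ ht).neg.exp).congr_deriv ?_
      ring) ht
  simp only [intervalIntegral.integral_same, neg_zero, Real.exp_zero, mul_one] at h1
  rw [← h1, mul_assoc, ← Real.exp_add]
  simp

/-- For nonzero energy `C₀`, the reduced equations become `P'' = 6P² - g₂/2` for
`P = C₀ / (2x) - α / 12`. -/
theorem IsReducedTrajectory.weierstrass {α C₀ : ℝ} {I : Set ℝ} (hI : IsTimeInterval I)
    {x ξ : ℝ → ℝ} (H : IsReducedTrajectory α I x ξ) (hC : C₀ ≠ 0)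
    (h₀ : x 0 * (x 0 ^ 2 + ξ 0 ^ 2 + α) / 2 = C₀) :
    ∃ P Q : ℝ → ℝ, (∀ t ∈ I, HasDerivAt P (Q t) t ∧ HasDerivAt Q (6 * P t ^ 2 - invG2 α / 2) t ∧
        x t = 1 / 2 * C₀ * (P t + 1 / 12 * α)⁻¹ ∧ ξ t = -Q t / (P t + 1 / 12 * α)) ∧
      Q 0 ^ 2 = 4 * P 0 ^ 3 - invG2 α * P 0 - invG3 α C₀ := by
  have hE : ∀ t ∈ I, x t * (x t ^ 2 + ξ t ^ 2 + α) / 2 = C₀ := fun t ht =>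
    (H.energy_eq hI ht).trans h₀
  have hx : ∀ t ∈ I, x t ≠ 0 := fun t ht h0 => hC (by rw [← hE t ht, h0]; ring)
  -- With q = C₀/(2x) and q' = -qξ, this gives q'² = 4q³ - αq² - C₀²/4; the shift q = P + α/12
  -- removes the quadratic term.
  have hq : ∀ t ∈ I, x t ^ 2 + ξ t ^ 2 + α = 4 * (C₀ / (2 * x t)) := fun t ht => by
    have := hx t ht
    field_simp
    linear_combination 4 * hE t ht
  refine ⟨fun t => C₀ / (2 * x t) - α / 12, fun t => -(C₀ / (2 * x t)) * ξ t,
    fun t ht => ⟨?_, ?_, ?_, ?_⟩, ?_⟩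
  · have hxt := hx t ht
    refine (((hasDerivAt_const t C₀).div ((H t ht).1.const_mul 2) (by simpa)).sub_const
      _).congr_deriv ?_
    field_simp
    ring
  · have hxt := hx t ht
    have hd := ((hasDerivAt_const t C₀).div ((H t ht).1.const_mul 2) (by simpa)).neg.mul (H t ht).2
    refine hd.congr_deriv ?_
    have h1 : -((0 * (2 * x t) - C₀ * (2 * (x t * ξ t))) / (2 * x t) ^ 2) =
        C₀ / (2 * x t) * ξ t := by field_simp; ring
    have h2 := hq t ht
    simp only [Pi.neg_apply, Pi.div_apply, h1, invG2]
    set q := C₀ / (2 * x t)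
    linear_combination (3 / 2 * q) * h2
  · have hxt := hx t ht
    field_simp
    ring
  · have hxt := hx t ht
    field_simp
    ring
  · have h2 := hq 0 hI.zero_mem
    have hxt := hx 0 hI.zero_mem
    have h3 : C₀ / (2 * x 0) * x 0 = C₀ / 2 := by field_simp
    simp only [invG2, invG3]
    set q := C₀ / (2 * x 0)
    linear_combination q ^ 2 * h2 - (q * x 0 + C₀ / 2) * h3

/-- Conversely, `P'² = 4P³ - g₂P - g₃` and `P'' = 6P² - g₂/2` give a solution of energy `C₀` of the
reduced equations. -/
theorem isReducedTrajectory_of_weierstrass {α C₀ : ℝ} (hC : C₀ ≠ 0) {I : Set ℝ}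
    (hI : IsTimeInterval I) {x ξ P Q : ℝ → ℝ}
    (hP : ∀ t ∈ I, HasDerivAt P (Q t) t ∧ HasDerivAt Q (6 * P t ^ 2 - invG2 α / 2) t ∧
      Q t ^ 2 = 4 * P t ^ 3 - invG2 α * P t - invG3 α C₀)
    (hx : ∀ t ∈ I, x t = 1 / 2 * C₀ * (P t + 1 / 12 * α)⁻¹)
    (hξ : ∀ t ∈ I, ξ t = -Q t / (P t + 1 / 12 * α)) :
    IsReducedTrajectory α I x ξ ∧ x 0 * (x 0 ^ 2 + ξ 0 ^ 2 + α) / 2 = C₀ := by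
  have hcub : ∀ t ∈ I, Q t ^ 2 = 4 * (P t + 1 / 12 * α) ^ 3 - α * (P t + 1 / 12 * α) ^ 2 -
      C₀ ^ 2 / 4 := fun t ht => by
    rw [(hP t ht).2.2, invG2, invG3]
    ring
  -- At a zero the cubic would equal -C₀²/4 < 0, which is not a real square.
  have hne : ∀ t ∈ I, P t + 1 / 12 * α ≠ 0 := fun t ht h0 => by
    have h1 := hcub t ht
    rw [h0] at h1
    have h2 : 0 < C₀ ^ 2 := by positivity
    nlinarith [sq_nonneg (Q t)]
  constructor
  · intro t ht
    have hev : ∀ᶠ s in 𝓝 t, s ∈ I := hI.isOpen.mem_nhds ht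
    have hq := hne t ht
    have hc := hcub t ht
    obtain ⟨h1, h2, -⟩ := hP t ht
    have h1' := h1.add_const (1 / 12 * α)
    constructor
    · refine (((h1'.inv hq).const_mul (1 / 2 * C₀)).congr_of_eventuallyEq
        (hev.mono hx)).congr_deriv ?_
      rw [hx t ht, hξ t ht]
      field_simp
    · refine ((h2.neg.div h1' hq).congr_of_eventuallyEq (hev.mono hξ)).congr_deriv ?_
      rw [hx t ht, hξ t ht]
      simp only [Pi.neg_apply, invG2]
      have h3 : 6 * P t ^ 2 - 1 / 12 * α ^ 2 / 2 =
        6 * (P t + 1 / 12 * α) ^ 2 - α * (P t + 1 / 12 * α) := by ring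
      rw [h3]
      set q := P t + 1 / 12 * α
      field_simp
      linear_combination 12 * hc
  · have hq := hne 0 hI.zero_mem
    have hc := hcub 0 hI.zero_mem
    rw [hx 0 hI.zero_mem, hξ 0 hI.zero_mem]
    set q := P 0 + 1 / 12 * α
    field_simp
    linear_combination 4 * hc

/-! ### Nonzero energy, nonzero discriminant -/

section Elliptic

open PeriodPair

variable {L : PeriodPair} {α C₀ : ℝ}

theorem HasInvariants.conj_mem_lattice {g₂ g₃ : ℝ} (hL : HasInvariants L g₂ g₃) :
    ∀ z ∈ L.lattice, starRingEnd ℂ z ∈ L.lattice := fun _ hz =>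
  PeriodPair.conj_mem_lattice (by rw [hL.1, Complex.conj_ofReal])
    (by rw [hL.2.1, Complex.conj_ofReal]) hz

/-- Along an admissible time shift, `℘` and `℘'` are real. -/
theorem HasInvariants.exists_real {g₂ g₃ : ℝ} (hL : HasInvariants L g₂ g₃) {t₀ : ℂ}
    (ht₀ : t₀ ∈ timeShifts L) (t : ℝ) :
    L.weierstrassP (t + t₀) = ((L.weierstrassP (t + t₀)).re : ℂ) ∧
      L.derivWeierstrassP (t + t₀) = ((L.derivWeierstrassP (t + t₀)).re : ℂ) := by
  have h := im_weierstrassP_eq_zero hL.conj_mem_lattice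
    (sub_conj_mem_lattice_of_mem_timeShifts hL.2.2 ht₀ t)
  exact ⟨Complex.ext (by simp) (by simp [h.1]), Complex.ext (by simp) (by simp [h.2])⟩

theorem HasInvariants.re_sq {g₂ g₃ : ℝ} (hL : HasInvariants L g₂ g₃) {t₀ : ℂ}
    (ht₀ : t₀ ∈ timeShifts L) {t : ℝ} (ht : (t : ℂ) + t₀ ∉ L.lattice) :
    (L.derivWeierstrassP (t + t₀)).re ^ 2 = 4 * (L.weierstrassP (t + t₀)).re ^ 3 -
      g₂ * (L.weierstrassP (t + t₀)).re - g₃ := by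
  have h := L.derivWeierstrassP_sq _ ht
  obtain ⟨h1, h2⟩ := hL.exists_real ht₀ t
  rw [hL.1, hL.2.1, h1, h2] at h
  exact_mod_cast h

/-- On admissible lines ℘' is real, but ℘ = -α/12 would force ℘'² = -C₀²/4. -/
theorem HasInvariants.weierstrassP_add_ne_zero
    (hL : HasInvariants L (invG2 α) (invG3 α C₀)) (hC : C₀ ≠ 0) {t₀ : ℂ}
    (ht₀ : t₀ ∈ timeShifts L) {t : ℝ} (ht : (t : ℂ) + t₀ ∉ L.lattice) :
    L.weierstrassP (t + t₀) + 1 / 12 * α ≠ 0 := by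
  intro h0
  have h1 := hL.re_sq ht₀ ht
  have h2 : (L.weierstrassP (t + t₀)).re = -(1 / 12 * α) := by
    have h5 : (1 / 12 * α : ℂ) = ((1 / 12 * α : ℝ) : ℂ) := by push_cast; ring
    rw [eq_neg_of_add_eq_zero_left h0, h5, ← Complex.ofReal_neg, Complex.ofReal_re]
  have h3 : 0 < C₀ ^ 2 := by positivity
  have h4 : (L.derivWeierstrassP (t + t₀)).re ^ 2 = -(C₀ ^ 2 / 4) := by
    rw [h1, h2, invG2, invG3]; ring
  nlinarith [sq_nonneg (L.derivWeierstrassP (t + t₀)).re]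

/-- The reduced trajectories of nonzero energy and nonzero discriminant. -/
theorem isReducedTrajectory_iff_isEllipticCurveMotion
    (hL : HasInvariants L (invG2 α) (invG3 α C₀)) (hC : C₀ ≠ 0) {I : Set ℝ}
    (hI : IsTimeInterval I) {x ξ : ℝ → ℝ} :
    (IsReducedTrajectory α I x ξ ∧ x 0 * (x 0 ^ 2 + ξ 0 ^ 2 + α) / 2 = C₀) ↔
      ∃ t₀ ∈ timeShifts L, IsEllipticCurveMotion L α C₀ t₀ I x ξ := by
  constructor
  · rintro ⟨H, h₀⟩
    obtain ⟨P, Q, hPQ, hcurve⟩ := H.weierstrass hI hC h₀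
    obtain ⟨t₀, ht₀, ht₀L, hP0, hQ0⟩ := exists_timeShift_weierstrassP_eq hL.conj_mem_lattice hL.2.2
      (X := P 0) (Y := Q 0) (by rw [hL.1, hL.2.1]; exact_mod_cast hcurve)
    refine ⟨t₀, ht₀, fun t ht => ?_⟩
    -- The comparison takes place in ℂ × ℂ, where the translated pair (℘, ℘') solves the same system
    -- and blows up exactly at the lattice times.
    have key := notMem_and_eq_of_hasDerivAt_autonomous (contDiff_weierstrass_vectorField L.g₂)
      hI.isOpen hI.isPreconnected (Z := (fun t : ℝ => (t : ℂ) + t₀) ⁻¹' L.lattice)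
      (L.isClosed_lattice.preimage (by fun_prop))
      (u := fun t => ((P t : ℂ), (Q t : ℂ)))
      (w := fun t => (L.weierstrassP (t + t₀), L.derivWeierstrassP (t + t₀)))
      (fun t ht => by
        refine (((hPQ t ht).1.ofReal_comp).prodMk (hPQ t ht).2.1.ofReal_comp).congr_deriv ?_
        simp [hL.1])
      (fun t ht => hasDerivAt_weierstrassP_pair t₀ ht) (fun t ht => by
        have hmap : Tendsto (fun s : ℝ => (s : ℂ) + t₀) (𝓝[≠] t) (𝓝[≠] ((t : ℂ) + t₀)) := by
          refine tendsto_nhdsWithin_iff.2 ⟨?_, ?_⟩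
          · have : Continuous fun s : ℝ => (s : ℂ) + t₀ := by fun_prop
            exact (this.tendsto t).mono_left nhdsWithin_le_nhds
          · filter_upwards [self_mem_nhdsWithin] with s hs
            simpa using hs
        rw [← tendsto_norm_atTop_iff_cobounded]
        exact tendsto_atTop_mono (fun s => le_max_left _ _) (tendsto_norm_atTop_iff_cobounded.2
          ((L.tendsto_weierstrassP_cobounded ht).comp hmap)))
      hI.zero_mem (by simpa using ht₀L) (by simp [hP0, hQ0]) t ht
    obtain ⟨hm, he⟩ := key
    simp only [Prod.mk.injEq] at he
    refine ⟨hm, ?_, ?_⟩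
    · rw [(hPQ t ht).2.2.1, ← he.1]; push_cast; ring
    · rw [(hPQ t ht).2.2.2, ← he.1, ← he.2]; push_cast; ring
  · rintro ⟨t₀, ht₀, H⟩
    refine isReducedTrajectory_of_weierstrass hC hI
      (P := fun t => (L.weierstrassP (t + t₀)).re) (Q := fun t => (L.derivWeierstrassP (t + t₀)).re)
      (fun t ht => ⟨?_, ?_, hL.re_sq ht₀ (H t ht).1⟩) (fun t ht => ?_) (fun t ht => ?_)
    · exact ((L.hasDerivAt_weierstrassP (H t ht).1).comp_add_const (t : ℂ) t₀).real_of_complex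
    · refine ((L.hasDerivAt_derivWeierstrassP (H t ht).1).comp_add_const (t : ℂ)
        t₀).real_of_complex.congr_deriv ?_
      rw [hL.1, (hL.exists_real ht₀ t).1]
      norm_cast
    · have h := (H t ht).2.1
      rw [(hL.exists_real ht₀ t).1] at h
      apply Complex.ofReal_injective
      push_cast
      exact h
    · have h := (H t ht).2.2
      rw [(hL.exists_real ht₀ t).1, (hL.exists_real ht₀ t).2] at h
      apply Complex.ofReal_injective
      push_cast
      exact h

end Elliptic

/-! ### Nonzero energy, zero discriminant -/

section Degenerate

theorem contDiff_real_weierstrass_vectorField (g : ℝ) :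
    ContDiff ℝ 1 (fun p : ℝ × ℝ => (p.2, 6 * p.1 ^ 2 - g / 2)) := by
  fun_prop

/-- The derivative of `degenerateWP`. -/
noncomputable def derivDegenerateWP (c s : ℝ) : ℝ :=
  -6 * c * √(3 * c) * Real.cos (√(3 * c) * s) / Real.sin (√(3 * c) * s) ^ 3

variable {c : ℝ}

theorem hasDerivAt_degenerateWP {s : ℝ} (hs : Real.sin (√(3 * c) * s) ≠ 0) :
    HasDerivAt (degenerateWP c) (derivDegenerateWP c s) s := by
  have h1 := ((hasDerivAt_id' s).const_mul √(3 * c)).sin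
  have h2 := ((hasDerivAt_const s (3 * c)).div (h1.pow 2) (pow_ne_zero 2 hs)).const_add (-c)
  refine h2.congr_deriv ?_
  simp only [derivDegenerateWP, Pi.pow_apply]
  field_simp
  ring

theorem hasDerivAt_derivDegenerateWP (hc : 0 ≤ c) {s : ℝ} (hs : Real.sin (√(3 * c) * s) ≠ 0) :
    HasDerivAt (derivDegenerateWP c) (6 * degenerateWP c s ^ 2 - 12 * c ^ 2 / 2) s := by
  have h0 := (hasDerivAt_id' s).const_mul √(3 * c)
  have h2 := (h0.cos.const_mul (-6 * c * √(3 * c))).div (h0.sin.pow 3) (pow_ne_zero 3 hs)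
  refine h2.congr_deriv ?_
  simp only [degenerateWP, Pi.pow_apply]
  have hsq : √(3 * c) ^ 2 = 3 * c := Real.sq_sqrt (by positivity)
  have hcs : Real.cos (√(3 * c) * s) ^ 2 = 1 - Real.sin (√(3 * c) * s) ^ 2 := by
    rw [← Real.sin_sq_add_cos_sq (√(3 * c) * s)]; ring
  set S := Real.sin (√(3 * c) * s)
  set C := Real.cos (√(3 * c) * s)
  set w := √(3 * c)
  field_simp
  push_cast
  ring_nf
  simp only [hcs, hsq]
  ring

theorem derivDegenerateWP_sq (hc : 0 ≤ c) {s : ℝ} (hs : Real.sin (√(3 * c) * s) ≠ 0) :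
    derivDegenerateWP c s ^ 2 =
      4 * degenerateWP c s ^ 3 - 12 * c ^ 2 * degenerateWP c s - 8 * c ^ 3 := by
  simp only [degenerateWP, derivDegenerateWP]
  have hsq : √(3 * c) ^ 2 = 3 * c := Real.sq_sqrt (by positivity)
  have hcs : Real.cos (√(3 * c) * s) ^ 2 = 1 - Real.sin (√(3 * c) * s) ^ 2 := by
    rw [← Real.sin_sq_add_cos_sq (√(3 * c) * s)]; ring
  rw [div_pow, mul_pow, mul_pow, hsq, hcs]
  set S := Real.sin (√(3 * c) * s)
  field_simp
  ring

theorem degenerateWP_neg (s : ℝ) : degenerateWP c (-s) = degenerateWP c s := by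
  simp [degenerateWP]

theorem derivDegenerateWP_neg (s : ℝ) : derivDegenerateWP c (-s) = -derivDegenerateWP c s := by
  simp only [derivDegenerateWP, mul_neg, Real.cos_neg, Real.sin_neg]
  rw [Odd.neg_pow (by decide), div_neg]

/-- The points of the nodal curve other than the node are parametrised by `degenerateWP`. -/
theorem exists_degenerateWP_eq (hc : 0 < c) {X Y : ℝ}
    (h : Y ^ 2 = 4 * X ^ 3 - 12 * c ^ 2 * X - 8 * c ^ 3) (hX : X ≠ -c) :
    ∃ s, Real.sin (√(3 * c) * s) ≠ 0 ∧ degenerateWP c s = X ∧ derivDegenerateWP c s = Y := by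
  have hXc : 0 < (X + c) ^ 2 := by
    have : X + c ≠ 0 := fun h0 => hX (by linarith)
    positivity
  -- Y² = 4(X - 2c)(X + c)²: the node is an isolated real point, and on the rest 3c/(X + c) lies in
  -- (0, 1], so it is a squared sine.
  have hX2 : 2 * c ≤ X := by
    by_contra! hlt
    have h1 : Y ^ 2 = 4 * (X - 2 * c) * (X + c) ^ 2 := by rw [h]; ring
    nlinarith [sq_nonneg Y, mul_pos (sub_pos.2 hlt) hXc]
  have hpos : 0 < X + c := by linarith
  have hsin : ∃ s, Real.sin (√(3 * c) * s) ≠ 0 ∧ degenerateWP c s = X := by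
    have hr : √(3 * c / (X + c)) ≤ 1 := Real.sqrt_le_one.2 (by
      rw [div_le_one hpos]; linarith)
    have hw : √(3 * c) ≠ 0 := (Real.sqrt_pos.2 (by positivity)).ne'
    have hrpos : 0 < √(3 * c / (X + c)) := Real.sqrt_pos.2 (by positivity)
    have hs : Real.sin (√(3 * c) * (Real.arcsin √(3 * c / (X + c)) / √(3 * c))) =
        √(3 * c / (X + c)) := by
      rw [mul_div_cancel₀ _ hw, Real.sin_arcsin (by linarith) hr]
    refine ⟨_, by rw [hs]; exact hrpos.ne', ?_⟩
    rw [degenerateWP, hs, Real.sq_sqrt (by positivity)]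
    field_simp
    ring
  obtain ⟨s, hs, hsX⟩ := hsin
  have h1 : derivDegenerateWP c s ^ 2 = Y ^ 2 := by rw [derivDegenerateWP_sq hc.le hs, hsX, h]
  rcases sq_eq_sq_iff_eq_or_eq_neg.1 h1 with h2 | h2
  · exact ⟨s, hs, hsX, h2⟩
  · exact ⟨-s, by simpa using hs, by rw [degenerateWP_neg, hsX],
      by rw [derivDegenerateWP_neg, h2, neg_neg]⟩

/-- The zeros of the sine are simple, so nearby its square is positive and tends to 0. -/
theorem tendsto_degenerateWP_cobounded (hc : 0 < c) {s : ℝ} (hs : Real.sin (√(3 * c) * s) = 0) :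
    Tendsto (degenerateWP c) (𝓝[≠] s) (Bornology.cobounded ℝ) := by
  have hw : √(3 * c) ≠ 0 := (Real.sqrt_pos.2 (by positivity)).ne'
  have hd := ((hasDerivAt_id' s).const_mul √(3 * c)).sin
  have hd0 : Real.cos (√(3 * c) * s) * (√(3 * c) * 1) ≠ 0 := by
    refine mul_ne_zero (fun h0 => ?_) (mul_ne_zero hw one_ne_zero)
    have := Real.sin_sq_add_cos_sq (√(3 * c) * s)
    rw [hs, h0] at this
    norm_num at this
  have h1 : Tendsto (fun s => Real.sin (√(3 * c) * s) ^ 2) (𝓝[≠] s) (𝓝[>] 0) := by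
    refine tendsto_nhdsWithin_iff.2 ⟨?_, ?_⟩
    · have := (hd.continuousAt.tendsto.pow 2).mono_left (nhdsWithin_le_nhds (s := {s}ᶜ))
      rwa [hs, zero_pow two_ne_zero] at this
    · filter_upwards [hd.eventually_ne hd0 (c := 0)] with t ht
      have : Real.sin (√(3 * c) * t) ≠ 0 := ht
      exact mem_Ioi.2 (by positivity)
  rw [← tendsto_norm_atTop_iff_cobounded]
  refine tendsto_norm_atTop_atTop.comp ?_
  exact tendsto_atTop_add_const_left _ _ (h1.inv_tendsto_nhdsGT_zero.const_mul_atTop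
    (show 0 < 3 * c by positivity))

variable {α C₀ : ℝ}

/-- The discriminant factors as -C₀²(α³ + 27C₀²)/16. -/
theorem neg_of_discr_eq_zero (hC : C₀ ≠ 0) (hD : invG2 α ^ 3 - 27 * invG3 α C₀ ^ 2 = 0) :
    α < 0 ∧ α ^ 3 = -(27 * C₀ ^ 2) := by
  have h1 : C₀ ^ 2 * (α ^ 3 + 27 * C₀ ^ 2) = 0 := by
    rw [invG2, invG3] at hD
    linear_combination -16 * hD
  have h2 : 0 < C₀ ^ 2 := by positivity
  have h3 : α ^ 3 = -(27 * C₀ ^ 2) := by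
    rcases mul_eq_zero.1 h1 with h | h
    · exact absurd h h2.ne'
    · linarith
  refine ⟨?_, h3⟩
  by_contra! h0
  have : 0 ≤ α ^ 3 := by positivity
  linarith

/-- The reduced trajectories of nonzero energy and zero discriminant. -/
theorem isReducedTrajectory_iff_degenerateWP (hC : C₀ ≠ 0)
    (hD : invG2 α ^ 3 - 27 * invG3 α C₀ ^ 2 = 0) {I : Set ℝ} (hI : IsTimeInterval I)
    {x ξ : ℝ → ℝ} :
    (IsReducedTrajectory α I x ξ ∧ x 0 * (x 0 ^ 2 + ξ 0 ^ 2 + α) / 2 = C₀) ↔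
      ((∃ t₀ : ℝ, ∀ t ∈ I, Real.sin (√(3 * (-α / 12)) * (t + t₀)) ≠ 0 ∧
          x t = 1 / 2 * C₀ * (degenerateWP (-α / 12) (t + t₀) + 1 / 12 * α)⁻¹ ∧
          ξ t = -deriv (degenerateWP (-α / 12)) (t + t₀) /
            (degenerateWP (-α / 12) (t + t₀) + 1 / 12 * α)) ∨
        (∀ t ∈ I, x t = 3 * C₀ / α ∧ ξ t = 0)) := by
  obtain ⟨hα, hα3⟩ := neg_of_discr_eq_zero hC hD
  set c := -α / 12 with hcdef
  have hc : 0 < c := by rw [hcdef]; linarith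
  have hαc : α = -12 * c := by rw [hcdef]; ring
  have hg2 : invG2 α = 12 * c ^ 2 := by rw [invG2, hαc]; ring
  have hg3 : invG3 α C₀ = 8 * c ^ 3 := by
    rw [invG3, show C₀ ^ 2 = -α ^ 3 / 27 by rw [hα3]; ring, hαc]; ring
  have hα0 := hα.ne
  constructor
  · rintro ⟨H, h₀⟩
    obtain ⟨P, Q, hPQ, hcurve⟩ := H.weierstrass hI hC h₀
    rw [hg2, hg3] at hcurve
    have hu : ∀ t ∈ I, HasDerivAt (fun t => (P t, Q t))
        ((P t, Q t).2, 6 * (P t, Q t).1 ^ 2 - invG2 α / 2) t := fun t ht =>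
      (hPQ t ht).1.prodMk (hPQ t ht).2.1
    -- The node is an equilibrium of P' = Q, Q' = 6P² - g₂/2, so starting there means staying there.
    by_cases hP0 : P 0 = -c
    · right
      have hQ0 : Q 0 = 0 := by
        rw [hP0] at hcurve
        exact pow_eq_zero_iff two_ne_zero |>.1 (hcurve.trans (by ring))
      intro t ht
      have key := notMem_and_eq_of_hasDerivAt_autonomous
        (contDiff_real_weierstrass_vectorField (invG2 α)) hI.isOpen hI.isPreconnected
        isClosed_empty hu (w := fun _ => (-c, 0)) (fun t _ => by
          refine (hasDerivAt_const t _).congr_deriv ?_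
          rw [hg2]
          exact Prod.ext rfl (by simp; ring)) (by simp) hI.zero_mem (by simp) (by simp [hP0, hQ0]) t ht
      simp only [Prod.mk.injEq] at key
      rw [(hPQ t ht).2.2.1, (hPQ t ht).2.2.2, key.2.1, key.2.2, hαc]
      refine ⟨?_, by simp⟩
      field_simp
      norm_num
    · left
      obtain ⟨t₀, hs, hsX, hsY⟩ := exists_degenerateWP_eq hc hcurve hP0
      refine ⟨t₀, fun t ht => ?_⟩
      have key := notMem_and_eq_of_hasDerivAt_autonomous
        (contDiff_real_weierstrass_vectorField (invG2 α)) hI.isOpen hI.isPreconnected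
        (Z := {t | Real.sin (√(3 * c) * (t + t₀)) = 0})
        (isClosed_eq (by fun_prop) (by fun_prop)) hu
        (w := fun t => (degenerateWP c (t + t₀), derivDegenerateWP c (t + t₀))) (fun t ht => by
          refine HasDerivAt.prodMk ((hasDerivAt_degenerateWP ht).comp_add_const t t₀) ?_
          rw [hg2]
          exact (hasDerivAt_derivDegenerateWP hc.le ht).comp_add_const t t₀) (fun t ht => by
          have hmap : Tendsto (fun s : ℝ => s + t₀) (𝓝[≠] t) (𝓝[≠] (t + t₀)) := by
            refine tendsto_nhdsWithin_iff.2 ⟨?_, ?_⟩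
            · exact ((continuous_add_const t₀).tendsto t).mono_left nhdsWithin_le_nhds
            · filter_upwards [self_mem_nhdsWithin] with s hs
              simpa using hs
          rw [← tendsto_norm_atTop_iff_cobounded]
          exact tendsto_atTop_mono (fun s => le_max_left _ _) (tendsto_norm_atTop_iff_cobounded.2
            ((tendsto_degenerateWP_cobounded hc ht).comp hmap)))
        hI.zero_mem (by simpa using hs) (by simp [hsX, hsY]) t ht
      simp only [Prod.mk.injEq] at key
      have hs' : Real.sin (√(3 * c) * (t + t₀)) ≠ 0 := key.1
      refine ⟨hs', ?_, ?_⟩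
      · rw [(hPQ t ht).2.2.1, key.2.1]
      · rw [(hPQ t ht).2.2.2, key.2.1, key.2.2, (hasDerivAt_degenerateWP hs').deriv]
  · rintro (⟨t₀, H⟩ | H)
    · refine isReducedTrajectory_of_weierstrass hC hI
        (P := fun t => degenerateWP c (t + t₀)) (Q := fun t => derivDegenerateWP c (t + t₀))
        (fun t ht => ⟨?_, ?_, ?_⟩) (fun t ht => (H t ht).2.1) (fun t ht => ?_)
      · exact (hasDerivAt_degenerateWP (H t ht).1).comp_add_const t t₀
      · rw [hg2]
        exact (hasDerivAt_derivDegenerateWP hc.le (H t ht).1).comp_add_const t t₀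
      · rw [hg2, hg3]
        exact derivDegenerateWP_sq hc.le (H t ht).1
      · rw [(H t ht).2.2, (hasDerivAt_degenerateWP (H t ht).1).deriv]
    -- By 27C₀² = -α³; this is exactly the equilibrium condition when ξ = 0.
    · have h9 : 3 * (3 * C₀ / α) ^ 2 = -α := by
        rw [div_pow, mul_pow, show C₀ ^ 2 = -α ^ 3 / 27 by rw [hα3]; ring]
        field_simp
        norm_num
      constructor
      · intro t ht
        have hev : ∀ᶠ s in 𝓝 t, s ∈ I := hI.isOpen.mem_nhds ht
        rw [(H t ht).1, (H t ht).2]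
        constructor
        · exact ((hasDerivAt_const t (3 * C₀ / α)).congr_of_eventuallyEq
            (hev.mono fun s hs => (H s hs).1)).congr_deriv (by ring)
        · exact ((hasDerivAt_const t (0 : ℝ)).congr_of_eventuallyEq
            (hev.mono fun s hs => (H s hs).2)).congr_deriv (by rw [h9]; ring)
      · rw [(H 0 hI.zero_mem).1, (H 0 hI.zero_mem).2]
        have : (3 * C₀ / α) ^ 2 = -α / 3 := by linarith
        rw [this]
        field_simp
        ring

end Degenerate

/-! ### Zero energy: Riccati equation and sech motions -/

section Riccati

variable {α m : ℝ} {I : Set ℝ} {x ξ : ℝ → ℝ}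

theorem riccati_notMem_and_eq (hI : IsTimeInterval I) {Z : Set ℝ} (hZ : IsClosed Z) {w : ℝ → ℝ}
    (hξ : ∀ t ∈ I, HasDerivAt ξ (-(ξ t ^ 2 + α) / 2) t)
    (hw : ∀ t ∉ Z, HasDerivAt w (-(w t ^ 2 + α) / 2) t)
    (hblow : ∀ t ∈ Z, Tendsto w (𝓝[≠] t) (Bornology.cobounded ℝ)) (h₀Z : 0 ∉ Z)
    (h : ξ 0 = w 0) : ∀ t ∈ I, t ∉ Z ∧ ξ t = w t :=
  notMem_and_eq_of_hasDerivAt_autonomous (v := fun s => -(s ^ 2 + α) / 2) (by fun_prop)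
    hI.isOpen hI.isPreconnected hZ hξ hw hblow hI.zero_mem h₀Z h

theorem riccati_of_eq (hI : IsTimeInterval I) {Z : Set ℝ} {w : ℝ → ℝ}
    (hw : ∀ t ∉ Z, HasDerivAt w (-(w t ^ 2 + α) / 2) t) (h : ∀ t ∈ I, t ∉ Z ∧ ξ t = w t) :
    ∀ t ∈ I, HasDerivAt ξ (-(ξ t ^ 2 + α) / 2) t := by
  intro t ht
  rw [(h t ht).2]
  refine (hw t (h t ht).1).congr_of_eventuallyEq ?_
  filter_upwards [hI.isOpen.mem_nhds ht] with s hs using (h s hs).2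

theorem hasDerivAt_tan_riccati (hα : 0 < α) (t₀ : ℝ) {t : ℝ}
    (ht : Real.cos (1 / 2 * √α * (t + t₀)) ≠ 0) :
    HasDerivAt (fun t => -√α * Real.tan (1 / 2 * √α * (t + t₀)))
      (-((-√α * Real.tan (1 / 2 * √α * (t + t₀))) ^ 2 + α) / 2) t := by
  have h1 := ((hasDerivAt_id' t).add_const t₀).const_mul (1 / 2 * √α)
  have h2 := ((Real.hasDerivAt_tan ht).comp t h1).const_mul (-√α)
  refine h2.congr_deriv ?_
  have hsq : √α ^ 2 = α := Real.sq_sqrt hα.le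
  have hcs := Real.sin_sq_add_cos_sq (1 / 2 * √α * (t + t₀))
  rw [Real.tan_eq_sin_div_cos, mul_pow, neg_sq, hsq, div_pow]
  set S := Real.sin (1 / 2 * √α * (t + t₀))
  set C := Real.cos (1 / 2 * √α * (t + t₀))
  field_simp
  linear_combination (-1 : ℝ) * hsq + α * hcs

theorem riccati_iff_tan (hα : 0 < α) (hI : IsTimeInterval I) :
    (∀ t ∈ I, HasDerivAt ξ (-(ξ t ^ 2 + α) / 2) t) ↔
      ∃ t₀ : ℝ, ∀ t ∈ I, Real.cos (1 / 2 * √α * (t + t₀)) ≠ 0 ∧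
        ξ t = -√α * Real.tan (1 / 2 * √α * (t + t₀)) := by
  have hs : 0 < √α := Real.sqrt_pos.2 hα
  constructor
  · intro H
    -- Chosen so that the tangent solution has the right value at time 0.
    set t₀ : ℝ := -Real.arctan (ξ 0 / √α) / (1 / 2 * √α) with ht₀
    have h0 : 1 / 2 * √α * (0 + t₀) = -Real.arctan (ξ 0 / √α) := by
      rw [ht₀]; field_simp; ring
    refine ⟨t₀, riccati_notMem_and_eq hI
      (Z := {t | Real.cos (1 / 2 * √α * (t + t₀)) = 0})
      (isClosed_eq (by fun_prop) continuous_const) H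
      (fun t ht => hasDerivAt_tan_riccati hα t₀ ht) (fun t ht => ?_) ?_ ?_⟩
    · have hmap : Tendsto (fun s : ℝ => 1 / 2 * √α * (s + t₀)) (𝓝[≠] t)
          (𝓝[≠] (1 / 2 * √α * (t + t₀))) := by
        refine tendsto_nhdsWithin_iff.2 ⟨?_, ?_⟩
        · have : Continuous fun s : ℝ => 1 / 2 * √α * (s + t₀) := by fun_prop
          exact (this.tendsto t).mono_left nhdsWithin_le_nhds
        · filter_upwards [self_mem_nhdsWithin] with s hs'
          intro heq
          refine hs' (add_right_cancel (mul_left_cancel₀ (b := s + t₀) (c := t + t₀) ?_ heq))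
          positivity
      have h2 := ((Real.tendsto_abs_tan_of_cos_eq_zero ht).comp hmap).const_mul_atTop hs
      rw [← tendsto_norm_atTop_iff_cobounded]
      refine h2.congr fun s => ?_
      rw [Real.norm_eq_abs, abs_mul, abs_neg, abs_of_pos hs]
      rfl
    · show ¬ Real.cos (1 / 2 * √α * (0 + t₀)) = 0
      rw [h0, Real.cos_neg]
      exact (Real.cos_arctan_pos _).ne'
    · simp only [h0, Real.tan_neg, Real.tan_arctan]
      field_simp
  · rintro ⟨t₀, H⟩
    exact riccati_of_eq hI (Z := {t | Real.cos (1 / 2 * √α * (t + t₀)) = 0})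
      (fun t ht => hasDerivAt_tan_riccati hα t₀ ht) H

theorem tendsto_add_punctured (t₀ t : ℝ) :
    Tendsto (fun s : ℝ => s + t₀) (𝓝[≠] t) (𝓝[≠] (t + t₀)) := by
  refine tendsto_nhdsWithin_iff.2 ⟨?_, ?_⟩
  · exact ((continuous_add_const t₀).tendsto t).mono_left nhdsWithin_le_nhds
  · filter_upwards [self_mem_nhdsWithin] with s hs
    simpa using hs

theorem hasDerivAt_inv_riccati (t₀ : ℝ) {t : ℝ} (ht : t + t₀ ≠ 0) :
    HasDerivAt (fun t => 2 / (t + t₀)) (-((2 / (t + t₀)) ^ 2 + 0) / 2) t := by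
  refine ((hasDerivAt_const t (2 : ℝ)).div ((hasDerivAt_id' t).add_const t₀) ht).congr_deriv ?_
  field_simp
  ring

theorem riccati_iff_inv (hI : IsTimeInterval I) :
    (∀ t ∈ I, HasDerivAt ξ (-(ξ t ^ 2 + 0) / 2) t) ↔
      (∀ t ∈ I, ξ t = 0) ∨ ∃ t₀ : ℝ, ∀ t ∈ I, t + t₀ ≠ 0 ∧ ξ t = 2 / (t + t₀) := by
  constructor
  · intro H
    by_cases h0 : ξ 0 = 0
    · exact Or.inl fun t ht => (riccati_notMem_and_eq hI isClosed_empty H (w := fun _ => 0)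
        (fun t _ => (hasDerivAt_const t (0 : ℝ)).congr_deriv (by simp)) (by simp) (by simp) h0 t ht).2
    · refine Or.inr ⟨2 / ξ 0, riccati_notMem_and_eq hI (Z := {t | t + 2 / ξ 0 = 0})
        (isClosed_eq (by fun_prop) continuous_const) H
        (fun t ht => hasDerivAt_inv_riccati _ ht) (fun t ht => ?_) ?_ ?_⟩
      · have h1 := tendsto_add_punctured (2 / ξ 0) t
        rw [show t + 2 / ξ 0 = 0 from ht] at h1
        have h2 := ((tendsto_norm_atTop_iff_cobounded.2 tendsto_inv₀_nhdsNE_zero).comp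
          h1).const_mul_atTop (two_pos (α := ℝ))
        rw [← tendsto_norm_atTop_iff_cobounded]
        refine h2.congr fun s => ?_
        simp [div_eq_mul_inv]
      · simpa using h0
      · simp
  · rintro (H | ⟨t₀, H⟩)
    · exact riccati_of_eq hI (Z := ∅) (w := fun _ => 0)
        (fun t _ => (hasDerivAt_const t (0 : ℝ)).congr_deriv (by simp))
        (fun t ht => ⟨by simp, H t ht⟩)
    · exact riccati_of_eq hI (Z := {t | t + t₀ = 0}) (fun t ht => hasDerivAt_inv_riccati _ ht) H

theorem hasDerivAt_real_tanh (s : ℝ) : HasDerivAt Real.tanh (1 - Real.tanh s ^ 2) s := by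
  have hc := (Real.cosh_pos s).ne'
  have h : Real.tanh = fun s => Real.sinh s / Real.cosh s := funext Real.tanh_eq_sinh_div_cosh
  rw [h]
  refine ((Real.hasDerivAt_sinh s).div (Real.hasDerivAt_cosh s) hc).congr_deriv ?_
  field_simp

theorem hasDerivAt_tanh_riccati (m t₀ t : ℝ) :
    HasDerivAt (fun t => m * Real.tanh (1 / 2 * m * (t + t₀)))
      (-((m * Real.tanh (1 / 2 * m * (t + t₀))) ^ 2 + -m ^ 2) / 2) t := by
  have h1 := ((hasDerivAt_id' t).add_const t₀).const_mul (1 / 2 * m)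
  refine (((hasDerivAt_real_tanh _).comp t h1).const_mul m).congr_deriv ?_
  ring

theorem tanh_ne_zero {s : ℝ} (hs : s ≠ 0) : Real.tanh s ≠ 0 := fun h =>
  hs (Real.tanh_injective (h.trans Real.tanh_zero.symm))

theorem hasDerivAt_coth_riccati (hm : 0 < m) (t₀ : ℝ) {t : ℝ} (ht : t + t₀ ≠ 0) :
    HasDerivAt (fun t => m * (Real.tanh (1 / 2 * m * (t + t₀)))⁻¹)
      (-((m * (Real.tanh (1 / 2 * m * (t + t₀)))⁻¹) ^ 2 + -m ^ 2) / 2) t := by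
  have h1 := ((hasDerivAt_id' t).add_const t₀).const_mul (1 / 2 * m)
  have h0 : Real.tanh (1 / 2 * m * (t + t₀)) ≠ 0 := tanh_ne_zero (by positivity)
  refine ((((hasDerivAt_real_tanh _).comp t h1).inv h0).const_mul m).congr_deriv ?_
  simp only [Function.comp_apply]
  set T := Real.tanh (1 / 2 * m * (t + t₀))
  field_simp
  ring

theorem tendsto_coth_cobounded (hm : 0 < m) (t₀ : ℝ) {t : ℝ} (ht : t + t₀ = 0) :
    Tendsto (fun t => m * (Real.tanh (1 / 2 * m * (t + t₀)))⁻¹) (𝓝[≠] t)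
      (Bornology.cobounded ℝ) := by
  have h1 : Tendsto (fun t => Real.tanh (1 / 2 * m * (t + t₀))) (𝓝[≠] t) (𝓝[≠] 0) := by
    refine tendsto_nhdsWithin_iff.2 ⟨?_, ?_⟩
    · have h1 := ((hasDerivAt_id' t).add_const t₀).const_mul (1 / 2 * m)
      have h2 := ((hasDerivAt_real_tanh _).comp t h1).continuousAt.tendsto
      simp only [Function.comp_apply, ht, mul_zero, Real.tanh_zero] at h2
      exact h2.mono_left nhdsWithin_le_nhds
    · filter_upwards [self_mem_nhdsWithin] with s hs
      have hs0 : s + t₀ ≠ 0 := fun h => hs (by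
        rw [mem_singleton_iff]; linarith)
      exact tanh_ne_zero (by positivity)
  have h2 := ((tendsto_norm_atTop_iff_cobounded.2 tendsto_inv₀_nhdsNE_zero).comp
    h1).const_mul_atTop hm
  rw [← tendsto_norm_atTop_iff_cobounded]
  refine h2.congr fun s => ?_
  rw [norm_mul, Real.norm_of_nonneg hm.le]
  rfl

theorem exists_tanh_eq {r : ℝ} (h : |r| < 1) : ∃ s, Real.tanh s = r :=
  ⟨Real.artanh r, Real.tanh_artanh (abs_lt.1 h)⟩

/-- The equilibria ±m separate the phase line: initial values between them follow tanh, those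
outside follow coth. -/
theorem riccati_iff_tanh (hm : 0 < m) (hI : IsTimeInterval I) :
    (∀ t ∈ I, HasDerivAt ξ (-(ξ t ^ 2 + -m ^ 2) / 2) t) ↔
      (∃ t₀ : ℝ, ∀ t ∈ I, ξ t = m * Real.tanh (1 / 2 * m * (t + t₀))) ∨
        (∃ t₀ : ℝ, ∀ t ∈ I, t + t₀ ≠ 0 ∧ ξ t = m * (Real.tanh (1 / 2 * m * (t + t₀)))⁻¹) ∨
        (∀ t ∈ I, ξ t = m) ∨ (∀ t ∈ I, ξ t = -m) := by
  have hconst : ∀ e : ℝ, e ^ 2 = m ^ 2 → ∀ t ∉ (∅ : Set ℝ),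
      HasDerivAt (fun _ : ℝ => e) (-(e ^ 2 + -m ^ 2) / 2) t := fun e he t _ =>
    (hasDerivAt_const t e).congr_deriv (by rw [he]; ring)
  constructor
  · intro H
    rcases lt_trichotomy |ξ 0| m with h | h | h
    · obtain ⟨s, hs⟩ := exists_tanh_eq (r := ξ 0 / m) (by rwa [abs_div, abs_of_pos hm, div_lt_one hm])
      refine Or.inl ⟨s / (1 / 2 * m), fun t ht => (riccati_notMem_and_eq hI isClosed_empty H
        (fun t _ => hasDerivAt_tanh_riccati m _ t) (by simp) (by simp) ?_ t ht).2⟩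
      rw [zero_add, mul_div_cancel₀ _ (by positivity), hs]
      field_simp
    · refine Or.inr (Or.inr ?_)
      rcases eq_or_eq_neg_of_abs_eq h with h' | h'
      · exact Or.inl fun t ht => (riccati_notMem_and_eq hI isClosed_empty H (hconst m rfl)
          (by simp) (by simp) h' t ht).2
      · exact Or.inr fun t ht => (riccati_notMem_and_eq hI isClosed_empty H
          (hconst (-m) (neg_sq m)) (by simp) (by simp) h' t ht).2
    · have h0 : ξ 0 ≠ 0 := fun h0 => by
        rw [h0, abs_zero] at h
        exact lt_asymm h hm
      -- Outside ±m the reciprocal m/ξ(0) is a nonzero number in (-1, 1), hence a hyperbolic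
      -- tangent.
      obtain ⟨s, hs⟩ := exists_tanh_eq (r := m / ξ 0) (by
        rwa [abs_div, abs_of_pos hm, div_lt_one (hm.trans h)])
      have hs0 : s ≠ 0 := fun hs0 => by
        rw [hs0, Real.tanh_zero] at hs
        exact div_ne_zero hm.ne' h0 hs.symm
      refine Or.inr (Or.inl ⟨s / (1 / 2 * m), riccati_notMem_and_eq hI
        (Z := {t | t + s / (1 / 2 * m) = 0}) (isClosed_eq (by fun_prop) continuous_const) H
        (fun t ht => hasDerivAt_coth_riccati hm _ ht) (fun t ht => tendsto_coth_cobounded hm _ ht)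
        ?_ ?_⟩)
      · show ¬ (0 + s / (1 / 2 * m) = 0)
        rw [zero_add]
        positivity
      · rw [zero_add, mul_div_cancel₀ _ (by positivity), hs]
        field_simp
  · rintro (⟨t₀, H⟩ | ⟨t₀, H⟩ | H | H)
    · exact riccati_of_eq hI (Z := ∅) (fun t _ => hasDerivAt_tanh_riccati m t₀ t)
        fun t ht => ⟨by simp, H t ht⟩
    · exact riccati_of_eq hI (Z := {t | t + t₀ = 0})
        (fun t ht => hasDerivAt_coth_riccati hm t₀ ht) H
    · exact riccati_of_eq hI (hconst m rfl) fun t ht => ⟨by simp, H t ht⟩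
    · exact riccati_of_eq hI (hconst (-m) (neg_sq m)) fun t ht => ⟨by simp, H t ht⟩

/-- The reduced trajectories of energy zero with `x ≡ 0`. -/
theorem isReducedTrajectory_iff_riccati (hI : IsTimeInterval I) (hx : ∀ t ∈ I, x t = 0) :
    IsReducedTrajectory α I x ξ ↔ ∀ t ∈ I, HasDerivAt ξ (-(ξ t ^ 2 + α) / 2) t := by
  constructor
  · intro H t ht
    refine (H t ht).2.congr_deriv ?_
    rw [hx t ht]
    ring
  · intro H t ht
    rw [hx t ht]
    constructor
    · refine ((hasDerivAt_const t (0 : ℝ)).congr_of_eventuallyEq ?_).congr_deriv (by ring)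
      filter_upwards [hI.isOpen.mem_nhds ht] with s hs using hx s hs
    · exact (H t ht).congr_deriv (by ring)

theorem IsReducedTrajectory.eq_zero (hI : IsTimeInterval I) (H : IsReducedTrajectory α I x ξ)
    (h0 : x 0 = 0) {t : ℝ} (ht : t ∈ I) : x t = 0 := by
  rw [H.eq_mul_exp_integral hI ht, h0, zero_mul]

theorem isReducedTrajectory_sech {ε : ℝ} (hε : ε ^ 2 = 1) (t₀ t : ℝ) :
    HasDerivAt (fun t => ε * (m * (Real.cosh (m * (t + t₀)))⁻¹))
      (ε * (m * (Real.cosh (m * (t + t₀)))⁻¹) * (-m * Real.tanh (m * (t + t₀)))) t ∧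
    HasDerivAt (fun t => -m * Real.tanh (m * (t + t₀)))
      (-(3 * (ε * (m * (Real.cosh (m * (t + t₀)))⁻¹)) ^ 2 +
        (-m * Real.tanh (m * (t + t₀))) ^ 2 + -m ^ 2) / 2) t := by
  have h1 := ((hasDerivAt_id' t).add_const t₀).const_mul m
  have hc := (Real.cosh_pos (m * (t + t₀))).ne'
  have hcs := Real.cosh_sq' (m * (t + t₀))
  constructor
  · refine (((h1.cosh.inv hc).const_mul m).const_mul ε).congr_deriv ?_
    rw [Real.tanh_eq_sinh_div_cosh]
    field_simp
  · refine (((hasDerivAt_real_tanh _).comp t h1).const_mul (-m)).congr_deriv ?_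
    rw [Real.tanh_eq_sinh_div_cosh, mul_pow, hε]
    field_simp
    linear_combination (-3 * m ^ 2) * hcs

/-- The reduced trajectories of energy zero with `x ≠ 0`. -/
theorem isReducedTrajectory_iff_sech (hm : 0 < m) (hI : IsTimeInterval I) :
    (IsReducedTrajectory (-m ^ 2) I x ξ ∧ x 0 ≠ 0 ∧ x 0 ^ 2 + ξ 0 ^ 2 = m ^ 2) ↔
      ∃ t₀ ε : ℝ, (ε = 1 ∨ ε = -1) ∧ ∀ t ∈ I,
        x t = ε * (m * (Real.cosh (m * (t + t₀)))⁻¹) ∧ ξ t = -m * Real.tanh (m * (t + t₀)) := by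
  constructor
  · rintro ⟨H, hx0, h0⟩
    have hx0' : 0 < x 0 ^ 2 := by positivity
    -- Because x(0) ≠ 0, ξ(0)² < m². The value of ξ(0) fixes s, the energy relation then fixes
    -- x(0)², and ε records its sign.
    obtain ⟨s, hs⟩ := exists_tanh_eq (r := -(ξ 0 / m)) (by
      rw [abs_neg, abs_div, abs_of_pos hm, div_lt_one hm]
      exact abs_lt_of_sq_lt_sq (by linarith) hm.le)
    have hξ0 : ξ 0 = -m * Real.tanh s := by rw [hs]; field_simp
    have hc := Real.cosh_pos s
    have hx2 : x 0 ^ 2 = (m * (Real.cosh s)⁻¹) ^ 2 := by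
      rw [hξ0, Real.tanh_eq_sinh_div_cosh] at h0
      have hcs := Real.cosh_sq' s
      field_simp at h0 ⊢
      linear_combination h0 + m ^ 2 * hcs
    obtain ⟨ε, hε, hxε⟩ : ∃ ε : ℝ, (ε = 1 ∨ ε = -1) ∧ x 0 = ε * (m * (Real.cosh s)⁻¹) := by
      rcases sq_eq_sq_iff_eq_or_eq_neg.1 hx2 with h | h
      · exact ⟨1, Or.inl rfl, by rw [h, one_mul]⟩
      · exact ⟨-1, Or.inr rfl, by rw [h, neg_one_mul]⟩
    have hε2 : ε ^ 2 = 1 := by rcases hε with rfl | rfl <;> norm_num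
    have hms : m * (0 + s / m) = s := by field_simp; ring
    refine ⟨s / m, ε, hε, fun t ht => ?_⟩
    have key := notMem_and_eq_of_hasDerivAt_autonomous
      (v := fun p : ℝ × ℝ => (p.1 * p.2, -(3 * p.1 ^ 2 + p.2 ^ 2 + -m ^ 2) / 2)) (by fun_prop)
      hI.isOpen hI.isPreconnected isClosed_empty (u := fun t => (x t, ξ t))
      (w := fun t => (ε * (m * (Real.cosh (m * (t + s / m)))⁻¹), -m * Real.tanh (m * (t + s / m))))
      (fun t ht => (H t ht).1.prodMk (H t ht).2)
      (fun t _ => (isReducedTrajectory_sech hε2 _ t).1.prodMk (isReducedTrajectory_sech hε2 _ t).2)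
      (by simp) hI.zero_mem (by simp) (by simp only [hms, ← hxε, ← hξ0]) t ht
    simpa only [Prod.mk.injEq] using key.2
  · rintro ⟨t₀, ε, hε, H⟩
    have hε2 : ε ^ 2 = 1 := by rcases hε with rfl | rfl <;> norm_num
    have hε0 : ε ≠ 0 := by rcases hε with rfl | rfl <;> norm_num
    refine ⟨fun t ht => ?_, ?_, ?_⟩
    · rw [(H t ht).1, (H t ht).2]
      have hev := hI.isOpen.mem_nhds ht
      constructor
      · refine (isReducedTrajectory_sech hε2 t₀ t).1.congr_of_eventuallyEq ?_
        filter_upwards [hev] with s hs using (H s hs).1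
      · refine (isReducedTrajectory_sech hε2 t₀ t).2.congr_of_eventuallyEq ?_
        filter_upwards [hev] with s hs using (H s hs).2
    · rw [(H 0 hI.zero_mem).1]
      have := Real.cosh_pos (m * (0 + t₀))
      positivity
    · rw [(H 0 hI.zero_mem).1, (H 0 hI.zero_mem).2, Real.tanh_eq_sinh_div_cosh, mul_pow, hε2]
      have hc := Real.cosh_pos (m * (0 + t₀))
      have hcs := Real.cosh_sq' (m * (0 + t₀))
      field_simp
      linear_combination (-1 : ℝ) * hcs

end Riccati

/-! ### Second-order equation, stationary points and the final assembly -/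

/-- In the time variable ∫x the pair (y, η) is a harmonic oscillator: y'/x = η and η'/x = -y. -/
theorem deriv_div_eq_of_hamilton {I : Set ℝ} (hI : IsOpen I) {x y η : ℝ → ℝ}
    (hx : ∀ t ∈ I, x t ≠ 0) (hy : ∀ t ∈ I, HasDerivAt y (x t * η t) t)
    (hη : ∀ t ∈ I, HasDerivAt η (-(x t * y t)) t) {t : ℝ} (ht : t ∈ I) :
    1 / x t * deriv (fun s => 1 / x s * deriv y s) t + y t = 0 := by
  have hev : (fun s => 1 / x s * deriv y s) =ᶠ[𝓝 t] η := by
    filter_upwards [hI.mem_nhds ht] with s hs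
    rw [(hy s hs).deriv]
    have := hx s hs
    field_simp
  rw [hev.deriv_eq, (hη t ht).deriv]
  have := hx t ht
  field_simp
  ring

theorem isHamiltonTrajectory_const_iff {h x₀ y₀ ξ₀ η₀ : ℝ} :
    IsHamiltonTrajectory (p4 h) univ (fun _ => x₀) (fun _ => y₀) (fun _ => ξ₀) (fun _ => η₀) ↔
      x₀ * ξ₀ = 0 ∧ x₀ * η₀ = 0 ∧
        -x₀ ^ 2 - 1 / 2 * (x₀ ^ 2 + y₀ ^ 2 + ξ₀ ^ 2 + η₀ ^ 2) + 5 / 2 * h = 0 ∧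
        x₀ * y₀ = 0 := by
  have hc : ∀ a b : ℝ, HasDerivAt (fun _ : ℝ => a) b 0 ↔ b = 0 := fun a b =>
    ⟨fun H => H.unique (hasDerivAt_const 0 a), fun H => (hasDerivAt_const (0 : ℝ) a).congr_deriv H.symm⟩
  rw [isHamiltonTrajectory_p4_iff]
  constructor
  · intro H
    have := H 0 (mem_univ _)
    rwa [hc, hc, hc, hc, neg_eq_zero] at this
  · rintro ⟨h1, h2, h3, h4⟩ t -
    rw [h1, h2, h3, h4, neg_zero]
    exact ⟨hasDerivAt_const _ _, hasDerivAt_const _ _, hasDerivAt_const _ _, hasDerivAt_const _ _⟩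

/-- The stationary points of the Hamiltonian system. -/
theorem stationary_iff {h : ℝ} (hh : 0 ≤ h) {x₀ y₀ ξ₀ η₀ : ℝ} :
    IsHamiltonTrajectory (p4 h) univ (fun _ => x₀) (fun _ => y₀) (fun _ => ξ₀) (fun _ => η₀) ↔
      (((x₀ = √(5 / 3 * h) ∨ x₀ = -√(5 / 3 * h)) ∧ y₀ = 0 ∧ ξ₀ = 0 ∧ η₀ = 0) ∨
        (x₀ = 0 ∧ y₀ ^ 2 + η₀ ^ 2 ≤ 5 * h ∧
          (ξ₀ = √(5 * h - (y₀ ^ 2 + η₀ ^ 2)) ∨ ξ₀ = -√(5 * h - (y₀ ^ 2 + η₀ ^ 2))))) := by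
  rw [isHamiltonTrajectory_const_iff]
  constructor
  · rintro ⟨h1, h2, h3, h4⟩
    by_cases hx : x₀ = 0
    · right
      subst hx
      have h5 : ξ₀ ^ 2 = 5 * h - (y₀ ^ 2 + η₀ ^ 2) := by linarith
      have h6 : y₀ ^ 2 + η₀ ^ 2 ≤ 5 * h := by linarith [sq_nonneg ξ₀]
      refine ⟨rfl, h6, ?_⟩
      rw [← sq_eq_sq_iff_eq_or_eq_neg, h5, Real.sq_sqrt (by linarith)]
    · left
      obtain rfl : ξ₀ = 0 := (mul_eq_zero.1 h1).resolve_left hx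
      obtain rfl : η₀ = 0 := (mul_eq_zero.1 h2).resolve_left hx
      obtain rfl : y₀ = 0 := (mul_eq_zero.1 h4).resolve_left hx
      refine ⟨?_, rfl, rfl, rfl⟩
      rw [← sq_eq_sq_iff_eq_or_eq_neg, Real.sq_sqrt (by positivity)]
      linarith
  · rintro (⟨hx, rfl, rfl, rfl⟩ | ⟨rfl, hle, hξ⟩)
    · rw [← sq_eq_sq_iff_eq_or_eq_neg, Real.sq_sqrt (by positivity)] at hx
      refine ⟨mul_zero _, mul_zero _, ?_, mul_zero _⟩
      linarith
    · rw [← sq_eq_sq_iff_eq_or_eq_neg, Real.sq_sqrt (by linarith)] at hξ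
      refine ⟨zero_mul _, zero_mul _, ?_, zero_mul _⟩
      linarith

/-- The reduced trajectories of energy zero, for `α ≥ 0`. -/
theorem energy_zero_iff_of_nonneg {α : ℝ} (hα : 0 ≤ α) {I : Set ℝ} (hI : IsTimeInterval I)
    {x y ξ η : ℝ → ℝ} :
    ((IsReducedTrajectory α I x ξ ∧ RotatesBy I x y η) ∧ x 0 * (x 0 ^ 2 + ξ 0 ^ 2 + α) / 2 = 0) ↔
      StaysAtZero I x y η ∧ ∀ t ∈ I, HasDerivAt ξ (-(ξ t ^ 2 + α) / 2) t := by
  rw [hI.staysAtZero_iff]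
  constructor
  · rintro ⟨⟨H, hR⟩, h0⟩
    have hx0 : x 0 = 0 := by
      by_contra hx
      -- For α ≥ 0 the second factor of the energy cannot vanish unless x does, so no sech branch
      -- occurs.
      have h1 : 0 < x 0 ^ 2 + ξ 0 ^ 2 + α := by positivity
      exact div_ne_zero (mul_ne_zero hx h1.ne') two_ne_zero h0
    have hx : ∀ t ∈ I, x t = 0 := fun t ht => H.eq_zero hI hx0 ht
    exact ⟨⟨hx, hR⟩, (isReducedTrajectory_iff_riccati hI hx).1 H⟩
  · rintro ⟨⟨hx, hR⟩, H⟩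
    exact ⟨⟨(isReducedTrajectory_iff_riccati hI hx).2 H, hR⟩, by simp [hx 0 hI.zero_mem]⟩

/-- The reduced trajectories of energy zero, for `α = -m² < 0`. -/
theorem energy_zero_iff_of_neg {m : ℝ} (hm : 0 < m) {I : Set ℝ} (hI : IsTimeInterval I)
    {x y ξ η : ℝ → ℝ} :
    ((IsReducedTrajectory (-m ^ 2) I x ξ ∧ RotatesBy I x y η) ∧
        x 0 * (x 0 ^ 2 + ξ 0 ^ 2 + -m ^ 2) / 2 = 0) ↔
      (∃ t₀ ε : ℝ, (ε = 1 ∨ ε = -1) ∧ (∀ t ∈ I, x t = ε * (m * (Real.cosh (m * (t + t₀)))⁻¹) ∧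
          ξ t = -m * Real.tanh (m * (t + t₀))) ∧ RotatesBy I x y η) ∨
        (StaysAtZero I x y η ∧ ∀ t ∈ I, HasDerivAt ξ (-(ξ t ^ 2 + -m ^ 2) / 2) t) := by
  rw [hI.staysAtZero_iff]
  constructor
  · rintro ⟨⟨H, hR⟩, h0⟩
    by_cases hx0 : x 0 = 0
    · have hx : ∀ t ∈ I, x t = 0 := fun t ht => H.eq_zero hI hx0 ht
      exact Or.inr ⟨⟨hx, hR⟩, (isReducedTrajectory_iff_riccati hI hx).1 H⟩
    · have h1 : x 0 ^ 2 + ξ 0 ^ 2 = m ^ 2 := by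
        have := (mul_eq_zero.1 ((div_eq_zero_iff.1 h0).resolve_right two_ne_zero)).resolve_left hx0
        linarith
      obtain ⟨t₀, ε, hε, h2⟩ := (isReducedTrajectory_iff_sech hm hI).1 ⟨H, hx0, h1⟩
      exact Or.inl ⟨t₀, ε, hε, h2, hR⟩
  · rintro (⟨t₀, ε, hε, h2, hR⟩ | ⟨⟨hx, hR⟩, H⟩)
    · obtain ⟨H, -, h1⟩ := (isReducedTrajectory_iff_sech hm hI).2 ⟨t₀, ε, hε, h2⟩
      exact ⟨⟨H, hR⟩, by rw [h1]; ring⟩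
    · exact ⟨⟨(isReducedTrajectory_iff_riccati hI hx).2 H, hR⟩, by simp [hx 0 hI.zero_mem]⟩

theorem mainTheorem5 (h : ℝ) :
    -- Hamilton's equations, written out
    (∀ (I : Set ℝ) (x y ξ η : ℝ → ℝ),
      IsHamiltonTrajectory (p4 h) I x y ξ η ↔
        ∀ t ∈ I,
          HasDerivAt x (x t * ξ t) t ∧
          HasDerivAt y (x t * η t) t ∧
          HasDerivAt ξ (-(x t) ^ 2 - 1 / 2 * (x t ^ 2 + y t ^ 2 + ξ t ^ 2 + η t ^ 2)
            + 5 / 2 * h) t ∧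
          HasDerivAt η (-(x t * y t)) t) ∧
    -- the conserved quantities
    (∀ (I : Set ℝ) (x y ξ η : ℝ → ℝ), IsTimeInterval I →
      IsHamiltonTrajectory (p4 h) I x y ξ η →
        ∀ t ∈ I,
          p4 h (x t) (y t) (ξ t) (η t) = p4 h (x 0) (y 0) (ξ 0) (η 0) ∧
          y t ^ 2 + η t ^ 2 = y 0 ^ 2 + η 0 ^ 2) ∧
    -- the relation between `x`, `ξ` and `y` when `C₀ ≠ 0`
    (∀ (I : Set ℝ) (x y ξ η : ℝ → ℝ), IsTimeInterval I →
      IsHamiltonTrajectory (p4 h) I x y ξ η → p4 h (x 0) (y 0) (ξ 0) (η 0) ≠ 0 →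
        ∀ t ∈ I, x t ≠ 0 ∧ ξ t = deriv x t / x t ∧
          1 / x t * deriv (fun s => 1 / x s * deriv y s) t + y t = 0) ∧
    -- the trajectories with `C₀ ≠ 0`, nonzero discriminant
    (∀ C₀ C₁ α : ℝ, α = C₁ ^ 2 - 5 * h → C₀ ≠ 0 →
      invG2 α ^ 3 - 27 * invG3 α C₀ ^ 2 ≠ 0 →
      (∃ L : PeriodPair, HasInvariants L (invG2 α) (invG3 α C₀)) ∧
      ∀ L : PeriodPair, HasInvariants L (invG2 α) (invG3 α C₀) →
        (∀ t₀ ∈ timeShifts L, ∀ t : ℝ, (t : ℂ) + t₀ ∉ L.lattice →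
          (L.weierstrassP (t + t₀)).im = 0 ∧ (L.derivWeierstrassP (t + t₀)).im = 0 ∧
          L.weierstrassP (t + t₀) + 1 / 12 * α ≠ 0) ∧
        ∀ (I : Set ℝ) (x y ξ η : ℝ → ℝ), IsTimeInterval I → y 0 ^ 2 + η 0 ^ 2 = C₁ ^ 2 →
          ((IsHamiltonTrajectory (p4 h) I x y ξ η ∧ p4 h (x 0) (y 0) (ξ 0) (η 0) = C₀) ↔
            ((∃ t₀ ∈ timeShifts L, IsEllipticCurveMotion L α C₀ t₀ I x ξ) ∧
              RotatesBy I x y η))) ∧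
    -- the trajectories with `C₀ ≠ 0`, zero discriminant
    (∀ C₀ C₁ α : ℝ, α = C₁ ^ 2 - 5 * h → C₀ ≠ 0 →
      invG2 α ^ 3 - 27 * invG3 α C₀ ^ 2 = 0 →
      α < 0 ∧
      ∀ (I : Set ℝ) (x y ξ η : ℝ → ℝ), IsTimeInterval I → y 0 ^ 2 + η 0 ^ 2 = C₁ ^ 2 →
        ((IsHamiltonTrajectory (p4 h) I x y ξ η ∧ p4 h (x 0) (y 0) (ξ 0) (η 0) = C₀) ↔
          (((∃ t₀ : ℝ, ∀ t ∈ I, Real.sin (√(3 * (-α / 12)) * (t + t₀)) ≠ 0 ∧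
                x t = 1 / 2 * C₀ * (degenerateWP (-α / 12) (t + t₀) + 1 / 12 * α)⁻¹ ∧
                ξ t = -deriv (degenerateWP (-α / 12)) (t + t₀) /
                  (degenerateWP (-α / 12) (t + t₀) + 1 / 12 * α)) ∨
              (∀ t ∈ I, x t = 3 * C₀ / α ∧ ξ t = 0)) ∧
            RotatesBy I x y η))) ∧
    -- the trajectories with `C₀ = 0`
    (∀ C₁ α : ℝ, α = C₁ ^ 2 - 5 * h →
      ∀ (I : Set ℝ) (x y ξ η : ℝ → ℝ), IsTimeInterval I → y 0 ^ 2 + η 0 ^ 2 = C₁ ^ 2 →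
        (0 < α →
          ((IsHamiltonTrajectory (p4 h) I x y ξ η ∧ p4 h (x 0) (y 0) (ξ 0) (η 0) = 0) ↔
            (StaysAtZero I x y η ∧
              ∃ t₀ : ℝ, ∀ t ∈ I, Real.cos (1 / 2 * √α * (t + t₀)) ≠ 0 ∧
                ξ t = -√α * Real.tan (1 / 2 * √α * (t + t₀))))) ∧
        (α = 0 →
          ((IsHamiltonTrajectory (p4 h) I x y ξ η ∧ p4 h (x 0) (y 0) (ξ 0) (η 0) = 0) ↔
            (StaysAtZero I x y η ∧
              ((∀ t ∈ I, ξ t = 0) ∨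
                ∃ t₀ : ℝ, ∀ t ∈ I, t + t₀ ≠ 0 ∧ ξ t = 2 / (t + t₀))))) ∧
        (α < 0 →
          ((IsHamiltonTrajectory (p4 h) I x y ξ η ∧ p4 h (x 0) (y 0) (ξ 0) (η 0) = 0) ↔
            ((∃ t₀ ε : ℝ, (ε = 1 ∨ ε = -1) ∧
                (∀ t ∈ I, x t = ε * (√(-α) * (Real.cosh (√(-α) * (t + t₀)))⁻¹) ∧
                  ξ t = -√(-α) * Real.tanh (√(-α) * (t + t₀))) ∧
                RotatesBy I x y η) ∨
              (StaysAtZero I x y η ∧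
                ((∃ t₀ : ℝ, ∀ t ∈ I, ξ t = √(-α) * Real.tanh (1 / 2 * √(-α) * (t + t₀))) ∨
                  (∃ t₀ : ℝ, ∀ t ∈ I, t + t₀ ≠ 0 ∧
                    ξ t = √(-α) * (Real.tanh (1 / 2 * √(-α) * (t + t₀)))⁻¹) ∨
                  (∀ t ∈ I, ξ t = √(-α)) ∨
                  (∀ t ∈ I, ξ t = -√(-α)))))))) ∧
    -- the stationary points
    (0 ≤ h → ∀ x₀ y₀ ξ₀ η₀ : ℝ,
      IsHamiltonTrajectory (p4 h) Set.univ (fun _ => x₀) (fun _ => y₀) (fun _ => ξ₀)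
          (fun _ => η₀) ↔
        (((x₀ = √(5 / 3 * h) ∨ x₀ = -√(5 / 3 * h)) ∧ y₀ = 0 ∧ ξ₀ = 0 ∧ η₀ = 0) ∨
          (x₀ = 0 ∧ y₀ ^ 2 + η₀ ^ 2 ≤ 5 * h ∧
            (ξ₀ = √(5 * h - (y₀ ^ 2 + η₀ ^ 2)) ∨ ξ₀ = -√(5 * h - (y₀ ^ 2 + η₀ ^ 2)))))) := by
  refine ⟨fun I x y ξ η => isHamiltonTrajectory_p4_iff, fun I x y ξ η hI H t ht => ?_,
    fun I x y ξ η hI H hC t ht => ?_, fun C₀ C₁ α hα hC hD => ⟨?_, fun L hL => ⟨?_, ?_⟩⟩,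
    fun C₀ C₁ α hα hC hD => ⟨(neg_of_discr_eq_zero hC hD).1, ?_⟩,
    fun C₁ α hα I x y ξ η hI h₀ => ?_, fun hh x₀ y₀ ξ₀ η₀ => stationary_iff hh⟩
  · obtain ⟨C₁, hC₁⟩ : ∃ C₁ : ℝ, y 0 ^ 2 + η 0 ^ 2 = C₁ ^ 2 :=
      ⟨√(y 0 ^ 2 + η 0 ^ 2), (Real.sq_sqrt (by positivity)).symm⟩
    obtain ⟨Hr, hR⟩ := (isHamiltonTrajectory_iff_isReducedTrajectory rfl hI hC₁).1 H
    have hsq := hR.sq_add_sq ht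
    exact ⟨by rw [p4_eq_of_sq_add_sq rfl (hsq.trans hC₁), p4_eq_of_sq_add_sq rfl hC₁,
      Hr.energy_eq hI ht], hsq⟩
  · obtain ⟨C₁, hC₁⟩ : ∃ C₁ : ℝ, y 0 ^ 2 + η 0 ^ 2 = C₁ ^ 2 :=
      ⟨√(y 0 ^ 2 + η 0 ^ 2), (Real.sq_sqrt (by positivity)).symm⟩
    obtain ⟨Hr, -⟩ := (isHamiltonTrajectory_iff_isReducedTrajectory rfl hI hC₁).1 H
    have hx : ∀ s ∈ I, x s ≠ 0 := fun s hs h0 => hC (by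
      rw [p4_eq_of_sq_add_sq rfl hC₁, ← Hr.energy_eq hI hs, h0, zero_mul, zero_div])
    have H' := isHamiltonTrajectory_p4_iff.1 H
    refine ⟨hx t ht, ?_, deriv_div_eq_of_hamilton hI.isOpen hx (fun s hs => (H' s hs).2.1)
      (fun s hs => (H' s hs).2.2.2) ht⟩
    rw [(H' t ht).1.deriv, mul_div_cancel_left₀ _ (hx t ht)]
  · exact PeriodPair.exists_of_real_invariants hD
  · intro t₀ ht₀ t ht
    obtain ⟨h1, h2⟩ := hL.exists_real ht₀ t
    exact ⟨by rw [h1, Complex.ofReal_im], by rw [h2, Complex.ofReal_im],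
      hL.weierstrassP_add_ne_zero hC ht₀ ht⟩
  · intro I x y ξ η hI h₀
    rw [isHamiltonTrajectory_iff_isReducedTrajectory hα hI h₀, p4_eq_of_sq_add_sq hα h₀,
      -- The energy condition involves only x and ξ, so it is regrouped with the reduced system,
      -- away from the rotation.
      ← isReducedTrajectory_iff_isEllipticCurveMotion hL hC hI, and_right_comm]
  · intro I x y ξ η hI h₀
    rw [isHamiltonTrajectory_iff_isReducedTrajectory hα hI h₀, p4_eq_of_sq_add_sq hα h₀,
      ← isReducedTrajectory_iff_degenerateWP hC hD hI, and_right_comm]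
  · rw [isHamiltonTrajectory_iff_isReducedTrajectory hα hI h₀, p4_eq_of_sq_add_sq hα h₀]
    refine ⟨fun hpos => ?_, fun hzero => ?_, fun hneg => ?_⟩
    · rw [energy_zero_iff_of_nonneg hpos.le hI, riccati_iff_tan hpos hI]
    · rw [hzero, energy_zero_iff_of_nonneg le_rfl hI, riccati_iff_inv hI]
    · have hm : 0 < √(-α) := Real.sqrt_pos.2 (neg_pos.2 hneg)
      have hαm : α = -√(-α) ^ 2 := by rw [Real.sq_sqrt (by linarith), neg_neg]
      set m := √(-α)
      rw [hαm, energy_zero_iff_of_neg hm hI, riccati_iff_tanh hm hI]
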